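/- Let $n\ge 1$ and $k\ge 1$ be integers, and let $K\subset\mathbb{R}^n$ be a (closed, nondegenerate) $n$-simplex with vertices $x_0,\dots,x_n$ and barycentric coordinates $\lambda_0,\dots,\lambda_n$. For a subsimplex $F$ of $K$ let $P_m(F)$ be the space of restrictions to $F$ of real polynomials of degree at most $m$ ($P_m(F)=0$ for $m<0$); let $P_k(K;\mathbb{S})$ be the space of symmetric $n\times n$ matrix fields on $K$ with entries in $P_k(K)$. Put $T_{i,j}=(x_j-x_i)(x_j-x_i)^T$ and $$\Sigma_{K,k,b}=\sum_{0\le i<j\le n}\lambda_i\lambda_jP_{k-2}(K)\,T_{i,j}.$$ For each $\ell$-dimensional subsimplex $F$ of $K$, $0\le\ell\le n-1$, fix $\ell$ linearly independent vectors $t_1,\dots,t_\ell$ tangential to $F$ and $n-\ell$ linearly independent vectors $\nu_1,\dots,\nu_{n-\ell}$ normal to $F$. Then a matrix field $\tau\in P_k(K;\mathbb{S})$ is uniquely determined by the following degrees of freedom: 1. for each $\ell$-dimensional subsimplex $F$ of $K$, $0\le\ell\le n-1$, the mean moments $$\frac1{|F|}\int_F (t_a^T\tau\nu_b)\,q\quad(1\le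 a\le\ell,\ 1\le b\le n-\ell),\qquad \frac1{|F|}\int_F (\nu_i^T\tau\nu_j)\,q\quad(1\le i\le j\le n-\ell),\qquad q\in P_{k-\ell-1}(F)$$ (for $\ell=0$, the mean over $F$ is the value at the vertex); 2. the values $\int_K\tau:\theta\,dx$ for $\theta\in\Sigma_{K,k,b}$, where $A:B=\sum_{i,j}A_{ij}B_{ij}$. More precisely, the linear map that sends $\tau\in P_k(K;\mathbb{S})$ to the collection of its moments (linear functionals of $q\in P_{k-\ell-1}(F)$, one for each $F$ and each component in 1, and a linear functional of $\theta\in\Sigma_{K,k,b}$) is a bijection onto the space of all such collections of linear functionals. Moreover, with $\binom{a}{b}=0$ for $a<b$: - there are $\binom{n+1}{\ell+1}$ subsimplices of dimension $\ell$, and each of them carries $\left(\binom{n+1-\ell}{2}+\ell(n-\ell)\right)\binom{k-1}{\ell}=\frac{(n-\ell)(n+\ell+1)}{2}\binom{k-1}{\ell}$ degrees of freedom of the first set; - the second set has $\frac{(n+1)n}{2}\binom{n+k-2}{n}$ degrees of freedom, which is $\dim\Sigma_{K,k,b}$; - the total number of degrees of freedom is $$\sum_{\ell=0}^{n-1}\binom{n+1}{\ell+1}\frac{(n-\ell)(n+\ell+1)}{2}\binom{k-1}{\ell}+\frac{(n+1)n}{2}\binom{n+k-2}{n}=\frac{n(n+1)}{2}\binom{n+k}{n}=\dim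 P_k(K;\mathbb{S}).$$ -/

import Mathlib

open MeasureTheory
open scoped Matrix

noncomputable section

namespace SymTensorElement

/-- Euclidean space `ℝⁿ`. -/
abbrev E (n : ℕ) : Type := EuclideanSpace ℝ (Fin n)

/-- A nondegenerate `n`-simplex in `ℝⁿ`, given by its `n + 1` affinely independent vertices. -/
abbrev Splx (n : ℕ) : Type := Affine.Simplex ℝ (E n) n

/-- `P_m(S; ℝ)`: the real functions on `S ⊆ ℝⁿ` that are restrictions of polynomials in the `n`
coordinates of degree at most `m`. For `m < 0` this is the zero space. -/
def polyOn {n : ℕ} (m : ℤ) (S : Set (E n)) : Submodule ℝ (S → ℝ) :=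
  (MvPolynomial.restrictSupport ℝ {d : Fin n →₀ ℕ | (d.degree : ℤ) ≤ m}).map
    (LinearMap.pi fun x : S => (MvPolynomial.aeval fun i => x.1 i).toLinearMap)

/-- `P_m(S; 𝕊)`: the symmetric `n × n` matrix fields on `S` with entries in `P_m(S; ℝ)`. -/
def symPolyOn {n : ℕ} (m : ℤ) (S : Set (E n)) :
    Submodule ℝ (S → Matrix (Fin n) (Fin n) ℝ) where
  carrier := {τ | (∀ x, (τ x).IsSymm) ∧ ∀ i j, (fun x => τ x i j) ∈ polyOn m S}
  add_mem' := fun {_ _} ha hb =>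
    ⟨fun x => (ha.1 x).add (hb.1 x), fun i j => (polyOn m S).add_mem (ha.2 i j) (hb.2 i j)⟩
  zero_mem' := ⟨fun _ => Matrix.isSymm_zero, fun _ _ => (polyOn m S).zero_mem⟩
  smul_mem' := fun c _ ha =>
    ⟨fun x => (ha.1 x).smul c, fun i j => (polyOn m S).smul_mem c (ha.2 i j)⟩

/-- The (closed) simplex itself, as a set of points. -/
def body {n : ℕ} (s : Splx n) : Set (E n) := convexHull ℝ (Set.range s.points)

/-- The subsimplex of `s` spanned by the vertices with index in `I`. -/
def face {n : ℕ} (s : Splx n) (I : Finset (Fin (n + 1))) : Set (E n) :=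
  convexHull ℝ (s.points '' (I : Set (Fin (n + 1))))

theorem face_subset_body {n : ℕ} (s : Splx n) (I : Finset (Fin (n + 1))) :
    face s I ⊆ body s :=
  convexHull_mono (Set.image_subset_range _ _)

/-- The vertex sets of the `ℓ`-dimensional subsimplices of an `n`-simplex. -/
abbrev FaceIdx (n ℓ : ℕ) : Type := {I : Finset (Fin (n + 1)) // I.card = ℓ + 1}

/-- The vertices of `s`, as an affine basis of `ℝⁿ`. -/
def vertexBasis {n : ℕ} (s : Splx n) : AffineBasis (Fin (n + 1)) ℝ (E n) :=
  ⟨s.points, s.independent, s.span_eq_top finrank_euclideanSpace_fin⟩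

/-- The barycentric coordinate `λ_i` of the simplex `s`. -/
def bary {n : ℕ} (s : Splx n) (i : Fin (n + 1)) (x : E n) : ℝ := (vertexBasis s).coord i x

/-- `T_{i,j} = t tᵀ`, with `t` the tangent vector of the edge from vertex `i` to vertex `j`. -/
def edgeTensor {n : ℕ} (s : Splx n) (i j : Fin (n + 1)) : Matrix (Fin n) (Fin n) ℝ :=
  Matrix.vecMulVec (s.points j - s.points i).ofLp (s.points j - s.points i).ofLp

/-- The bubble space `Σ_{K,k,b} = ∑_{i<j} λ_i λ_j P_{k-2}(K; ℝ) T_{i,j}` on `K = body s`. -/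
def bubble {n : ℕ} (s : Splx n) (k : ℕ) :
    Submodule ℝ (body s → Matrix (Fin n) (Fin n) ℝ) :=
  Submodule.span ℝ {θ | ∃ i j : Fin (n + 1), i < j ∧ ∃ q ∈ polyOn ((k : ℤ) - 2) (body s),
    θ = fun x : body s => (bary s i x.1 * bary s j x.1 * q x) • edgeTensor s i j}

/-- `t` is a family of `ℓ` linearly independent tangential vectors and `ν` a family of `n - ℓ`
linearly independent normal vectors of the `ℓ`-dimensional subsimplex with vertex set `I`. -/
structure IsFrame {n : ℕ} (s : Splx n) {ℓ : ℕ} (I : FaceIdx n ℓ)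
    (t : Fin ℓ → E n) (ν : Fin (n - ℓ) → E n) : Prop where
  tangent_mem : ∀ a, t a ∈ vectorSpan ℝ (s.points '' (I.1 : Set (Fin (n + 1))))
  tangent_indep : LinearIndependent ℝ t
  normal_mem : ∀ b, ν b ∈ (vectorSpan ℝ (s.points '' (I.1 : Set (Fin (n + 1)))))ᗮ
  normal_indep : LinearIndependent ℝ ν

/-- The mean moment `|F|⁻¹ ∫_F (uᵀ τ v) q` over the `ℓ`-dimensional subsimplex `F` with vertex
set `I`. The integral is with respect to `ℓ`-dimensional volume (Hausdorff measure, normalized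
as Lebesgue measure); for `ℓ = 0` it is the value at the vertex. -/
def meanMoment {n : ℕ} (s : Splx n) {ℓ : ℕ} (I : FaceIdx n ℓ)
    (τ : body s → Matrix (Fin n) (Fin n) ℝ) (u v : E n) (q : face s I.1 → ℝ) : ℝ :=
  ⨍ x : face s I.1,
    (u.ofLp ⬝ᵥ (τ (Set.inclusion (face_subset_body s I.1) x) *ᵥ v.ofLp)) * q x
      ∂(Measure.euclideanHausdorffMeasure ℓ)

/-- `∫_K τ : θ dx`, with `A : B = ∑ᵢⱼ AᵢⱼBᵢⱼ` and `K = body s`. -/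
def interiorMoment {n : ℕ} (s : Splx n) (τ θ : body s → Matrix (Fin n) (Fin n) ℝ) : ℝ :=
  ∫ x : body s, ∑ i, ∑ j, τ x i j * θ x i j ∂((volume : Measure (E n)).comap Subtype.val)

/-- The space of all conceivable values of the degrees of freedom on one `ℓ`-dimensional
subsimplex `F`. For each tangential–normal component (indexed by `(a, b)`) and each
normal–normal component (indexed by pairs `i ≤ j`, since `τ` is symmetric) the moments of degree
at most `k - ℓ - 1` form a linear functional on `P_{k-ℓ-1}(F; ℝ)`. -/
abbrev FaceDofs {n : ℕ} (s : Splx n) (k : ℕ) {ℓ : ℕ} (I : FaceIdx n ℓ) : Type :=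
  (Fin ℓ → Fin (n - ℓ) → Module.Dual ℝ (polyOn ((k : ℤ) - ℓ - 1) (face s I.1))) ×
  ({p : Fin (n - ℓ) × Fin (n - ℓ) // p.1 ≤ p.2} →
    Module.Dual ℝ (polyOn ((k : ℤ) - ℓ - 1) (face s I.1)))

/-- The space of all conceivable values of the degrees of freedom: those on the subsimplices of
dimension `0 ≤ ℓ ≤ n - 1`, and the interior moments, a linear functional on the bubble space. -/
abbrev Dofs {n : ℕ} (s : Splx n) (k : ℕ) : Type :=
  ((ℓ : Fin n) → (I : FaceIdx n ℓ) → FaceDofs s k I) × Module.Dual ℝ (bubble s k)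

end SymTensorElement

end

noncomputable section

namespace SymTensorElement

open MvPolynomial

/-! ### Barycentric coordinates and faces -/

section Barycentric

variable {n : ℕ} (s : Splx n)

/-! The space of degrees of freedom has the dimension of $P_k(K;\mathbb S)$, so it suffices that a
field $\tau$ with vanishing moments is zero.

Let $v$ be normal to a proper face $F$ of dimension $\ell$. It is also normal to every facet of $F$,
so by induction over faces each component $u^T\tau v$ vanishes on $\partial F$. It is therefore the
product of the $\ell+1$ barycentric coordinates of $F$ with some $q\in P_{k-\ell-1}(F)$. Testing
against this $q$ gives a nonnegative integrand with zero mean, so the component is zero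
(`eq_zero_of_vanish_of_moments`). With $u$ running over tangents and normals, $\tau v=0$ on $F$
(`mulVec_normal_eq_zero`).

The facet opposite $x_m$ has normal $\nabla\lambda_m$. The tensors $T_{i,j}$ are, up to sign, dual
to the functionals $S\mapsto\nabla\lambda_i\cdot S\nabla\lambda_j$, $i<j$, hence
$\tau=-\sum_{i<j}(\nabla\lambda_i\cdot\tau\nabla\lambda_j)T_{i,j}$ (`edgeCombo_grad`). Each
coefficient vanishes on the facets opposite $x_i$ and $x_j$, so $\lambda_i\lambda_j$ divides it and
$\tau$ is in the bubble space (`mem_bubble_of_mulVec_grad`). The choice $\theta=\tau$ in the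
interior moments then gives $\int_K\tau:\tau=0$.

Divisibility and dimensions both come from writing $P_m$ as homogeneous polynomials of degree $m$ in
the barycentric coordinates (`polyOn_eq_map`): vanishing on a face becomes a condition on single
coefficients (`coeff_eq_zero_of_vanish`). The count of degrees of freedom is a pair of Vandermonde
convolutions (`sum_dofs`). -/

theorem bary_point (i j : Fin (n + 1)) : bary s i (s.points j) = if i = j then 1 else 0 :=
  (vertexBasis s).coord_apply i j

theorem sum_bary (x : E n) : ∑ i, bary s i x = 1 :=
  (vertexBasis s).sum_coord_apply_eq_one x

theorem sum_bary_smul (x : E n) : ∑ i, bary s i x • s.points i = x :=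
  (vertexBasis s).linear_combination_coord_eq_self x

theorem continuous_bary (i : Fin (n + 1)) : Continuous (bary s i) :=
  ((vertexBasis s).coord i).continuous_of_finiteDimensional

theorem coord_eq_sum_bary (x : E n) (c : Fin n) : x c = ∑ i, bary s i x * s.points i c := by
  conv_lhs => rw [← sum_bary_smul s x]
  simp

theorem exists_bary_eq (w : Fin (n + 1) → ℝ) (hw : ∑ i, w i = 1) :
    ∃ x : E n, ∀ i, bary s i x = w i :=
  ⟨Finset.univ.affineCombination ℝ (vertexBasis s) w, fun i =>
    (vertexBasis s).coord_apply_combination_of_mem (Finset.mem_univ i) hw⟩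

/-- This description lets faces be handled through monomials: on the face of $I$, exactly those in
the variables of $I$ can survive. -/
theorem mem_face_iff (I : Finset (Fin (n + 1))) (x : E n) :
    x ∈ face s I ↔ (∀ i, 0 ≤ bary s i x) ∧ ∀ i, i ∉ I → bary s i x = 0 := by
  constructor
  · intro hx
    have hconv : Convex ℝ {x : E n | (∀ i, 0 ≤ bary s i x) ∧ ∀ i, i ∉ I → bary s i x = 0} := by
      intro x hx y hy a b ha hb hab
      have key : ∀ i, bary s i (a • x + b • y) = a * bary s i x + b * bary s i y := fun i =>
        Convex.combo_affine_apply hab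
      refine ⟨fun i => ?_, fun i hi => ?_⟩
      · rw [key]
        have := hx.1 i
        have := hy.1 i
        positivity
      · rw [key, hx.2 i hi, hy.2 i hi]
        simp
    refine convexHull_min ?_ hconv hx
    rintro _ ⟨j, hj, rfl⟩
    refine ⟨fun i => ?_, fun i hi => ?_⟩
    · rw [bary_point]
      split_ifs <;> norm_num
    · rw [bary_point, if_neg]
      rintro rfl
      exact hi hj
  · rintro ⟨h0, h1⟩
    have hsum : ∀ {M : Type} [AddCommMonoid M] (f : Fin (n + 1) → M), (∀ i, i ∉ I → f i = 0) →
        ∑ i ∈ I, f i = ∑ i, f i := fun f hf =>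
      Finset.sum_subset (Finset.subset_univ _) fun i _ hi => hf i hi
    have hx : ∑ i ∈ I, bary s i x • s.points i = x := by
      rw [hsum _ fun i hi => by rw [h1 i hi, zero_smul], sum_bary_smul]
    rw [← hx]
    refine (convex_convexHull ℝ _).sum_mem (fun i _ => h0 i) ?_ fun i hi =>
      subset_convexHull ℝ _ ⟨i, hi, rfl⟩
    rw [hsum _ h1, sum_bary]

theorem face_univ : face s Finset.univ = body s := by
  simp [face, body]

theorem isCompact_face (I : Finset (Fin (n + 1))) : IsCompact (face s I) :=
  (Set.toFinite _).isCompact_convexHull (𝕜 := ℝ)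

theorem isCompact_body : IsCompact (body s) := face_univ s ▸ isCompact_face s _

instance (I : Finset (Fin (n + 1))) : CompactSpace (face s I) :=
  isCompact_iff_compactSpace.1 (isCompact_face s I)

instance : CompactSpace (body s) := isCompact_iff_compactSpace.1 (isCompact_body s)

end Barycentric

/-! ### Polynomials in barycentric coordinates -/

/-- The homogeneous polynomials of degree `m` (none but `0` for `m < 0`) in the barycentric
coordinates. -/
def hom (n : ℕ) (m : ℤ) : Submodule ℝ (MvPolynomial (Fin (n + 1)) ℝ) :=
  restrictSupport ℝ {d : Fin (n + 1) →₀ ℕ | (d.degree : ℤ) = m}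

theorem mem_hom_iff {n : ℕ} {m : ℤ} {P : MvPolynomial (Fin (n + 1)) ℝ} :
    P ∈ hom n m ↔ ∀ d, coeff d P ≠ 0 → (d.degree : ℤ) = m := by
  rw [hom, mem_restrictSupport_iff]
  simp [Set.subset_def]

theorem mem_hom_natCast_iff {n m : ℕ} {P : MvPolynomial (Fin (n + 1)) ℝ} :
    P ∈ hom n (m : ℤ) ↔ P.IsHomogeneous m := by
  rw [mem_hom_iff, IsHomogeneous, IsWeightedHomogeneous]
  simp [Pi.one_def, ← Finsupp.degree_eq_weight_one]

/-- Evaluation of polynomials in the barycentric coordinates on a set. -/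
def baryEval {n : ℕ} (s : Splx n) (S : Set (E n)) :
    MvPolynomial (Fin (n + 1)) ℝ →ₗ[ℝ] (S → ℝ) :=
  LinearMap.pi fun x : S => (MvPolynomial.aeval fun i => bary s i x.1).toLinearMap

theorem baryEval_apply {n : ℕ} (s : Splx n) (S : Set (E n)) (P : MvPolynomial (Fin (n + 1)) ℝ)
    (x : S) : baryEval s S P x = eval (fun i => bary s i x.1) P := by
  simp [baryEval, MvPolynomial.aeval_eq_eval]

/-- The barycentric coordinate functions as polynomials of degree at most one in the Cartesian
coordinates. -/
theorem exists_bary_eq_eval {n : ℕ} (s : Splx n) (i : Fin (n + 1)) :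
    ∃ L : MvPolynomial (Fin n) ℝ, L.totalDegree ≤ 1 ∧ ∀ x : E n, eval (fun c => x c) L = bary s i x := by
  set A := (vertexBasis s).coord i
  refine ⟨C (A 0) + ∑ c, C (A.linear (EuclideanSpace.single c 1)) * X c, ?_, fun x => ?_⟩
  · refine (totalDegree_add _ _).trans (max_le (by simp) ?_)
    refine (totalDegree_finsetSum _ _).trans (Finset.sup_le fun c _ => ?_)
    refine (totalDegree_mul _ _).trans ?_
    simp
  · have hx : x = ∑ c, x c • EuclideanSpace.single c (1 : ℝ) := by
      ext c
      simp [Finset.sum_apply, Pi.single_apply]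
    have h : A x = A.linear x + A 0 := by
      have := A.map_vadd 0 x
      simpa using this
    change _ = A x
    rw [h]
    conv_rhs => rw [hx, map_sum]
    simp [add_comm, mul_comm]

/-- Since $\sum_i\lambda_i=1$, a polynomial of degree at most $m$ can be homogenized to degree
exactly $m$ without changing its values. Homogeneity is what later makes the representing polynomial
unique. -/
theorem polyOn_eq_map {n : ℕ} (s : Splx n) (m : ℤ) (S : Set (E n)) :
    polyOn m S = (hom n m).map (baryEval s S) := by
  apply le_antisymm
  · rw [polyOn, restrictSupport_eq_span, Submodule.map_span, Submodule.span_le]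
    rintro _ ⟨_, ⟨d, hd, rfl⟩, rfl⟩
    have hd : (d.degree : ℤ) ≤ m := hd
    obtain ⟨m, rfl⟩ := Int.eq_ofNat_of_zero_le (le_trans (Int.natCast_nonneg _) hd)
    have hd' : d.degree ≤ m := by exact_mod_cast hd
    -- Each coordinate $x_c$ is replaced by $\sum_i\lambda_i(x_i)_c$, and the missing degree is
    -- filled with powers of $\sum_i\lambda_i=1$.
    refine ⟨(∏ c, (∑ i, C (s.points i c) * X i) ^ d c) * (∑ i, X i) ^ (m - d.degree), ?_, ?_⟩
    · rw [SetLike.mem_coe]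
      refine mem_hom_natCast_iff.2 ?_
      have h1 : (∏ c, (∑ i, C (s.points i c) * X i : MvPolynomial (Fin (n + 1)) ℝ) ^ d c).IsHomogeneous
          (∑ c, d c) := by
        refine IsHomogeneous.prod _ _ _ fun c _ => ?_
        have : (∑ i, C (s.points i c) * X i : MvPolynomial (Fin (n + 1)) ℝ).IsHomogeneous 1 :=
          IsHomogeneous.sum _ _ _ fun i _ => by
            simpa using (isHomogeneous_C (Fin (n + 1)) (s.points i c)).mul (isHomogeneous_X ℝ i)
        simpa using this.pow (d c)
      have h2 : ((∑ i, X i : MvPolynomial (Fin (n + 1)) ℝ) ^ (m - d.degree)).IsHomogeneous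
          (m - d.degree) := by
        have : (∑ i, X i : MvPolynomial (Fin (n + 1)) ℝ).IsHomogeneous 1 :=
          IsHomogeneous.sum _ _ _ fun i _ => isHomogeneous_X ℝ i
        simpa using this.pow (m - d.degree)
      have h3 := h1.mul h2
      rwa [← Finsupp.degree_eq_sum, Nat.add_sub_cancel' hd'] at h3
    · ext x
      rw [baryEval_apply]
      simp only [map_mul, map_prod, map_pow, map_sum, eval_C, eval_X, sum_bary, one_pow, mul_one]
      simp [aeval_monomial, Finsupp.prod_fintype, coord_eq_sum_bary s x.1, mul_comm]
  · rw [hom, restrictSupport_eq_span, Submodule.map_span, Submodule.span_le]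
    rintro _ ⟨_, ⟨d, hd, rfl⟩, rfl⟩
    have hd : (d.degree : ℤ) = m := hd
    choose L hL hLx using exists_bary_eq_eval s
    refine ⟨∏ i, L i ^ d i, ?_, ?_⟩
    · rw [SetLike.mem_coe, mem_restrictSupport_iff]
      intro e he
      have h1 := le_totalDegree he
      have h2 : (∏ i, L i ^ d i).totalDegree ≤ ∑ i, d i := by
        refine (totalDegree_finsetProd _ _).trans (Finset.sum_le_sum fun i _ => ?_)
        exact (totalDegree_pow _ _).trans (by simpa using Nat.mul_le_mul_left (d i) (hL i))
      have h3 : e.degree ≤ d.degree := by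
        rw [Finsupp.degree_eq_sum d]
        exact h1.trans h2
      change (e.degree : ℤ) ≤ m
      omega
    · ext x
      rw [baryEval_apply]
      have : ∀ P : MvPolynomial (Fin n) ℝ, (LinearMap.pi (R := ℝ) fun x : S =>
          (MvPolynomial.aeval fun i => x.1 i).toLinearMap) P x = eval (fun c => x.1 c) P :=
        fun P => by simp [MvPolynomial.aeval_eq_eval]
      rw [this]
      simp [hLx, eval_monomial, Finsupp.prod_fintype]

theorem mem_polyOn_iff {n : ℕ} (s : Splx n) {m : ℤ} {S : Set (E n)} {f : S → ℝ} :
    f ∈ polyOn m S ↔ ∃ P ∈ hom n m, ∀ x : S, f x = eval (fun i => bary s i x.1) P := by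
  rw [polyOn_eq_map s, Submodule.mem_map]
  refine exists_congr fun P => and_congr_right fun _ => ?_
  rw [funext_iff]
  refine forall_congr' fun x => ?_
  rw [baryEval_apply, eq_comm]

theorem continuous_of_mem_polyOn {n : ℕ} {m : ℤ} {S : Set (E n)} {f : S → ℝ}
    (hf : f ∈ polyOn m S) : Continuous f := by
  obtain ⟨P, -, rfl⟩ := hf
  have : Continuous fun x : S => eval (fun c => x.1 c) P :=
    (MvPolynomial.continuous_eval P).comp (by fun_prop)
  convert this using 2 with x
  simp [MvPolynomial.aeval_eq_eval]

/-- The part of a polynomial consisting of the monomials in the variables with index in `I`. -/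
def onVars {n : ℕ} (I : Finset (Fin (n + 1))) (P : MvPolynomial (Fin (n + 1)) ℝ) :
    MvPolynomial (Fin (n + 1)) ℝ :=
  ∑ d ∈ P.support with d.support ⊆ I, monomial d (coeff d P)

theorem coeff_onVars {n : ℕ} (I : Finset (Fin (n + 1))) (P : MvPolynomial (Fin (n + 1)) ℝ)
    (d : Fin (n + 1) →₀ ℕ) : coeff d (onVars I P) = if d.support ⊆ I then coeff d P else 0 := by
  rw [onVars, coeff_sum]
  simp only [coeff_monomial, Finset.sum_ite_eq', Finset.mem_filter, mem_support_iff]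
  split_ifs <;> simp_all

theorem eval_onVars {n : ℕ} {I : Finset (Fin (n + 1))} (P : MvPolynomial (Fin (n + 1)) ℝ)
    {w : Fin (n + 1) → ℝ} (hw : ∀ i, i ∉ I → w i = 0) : eval w (onVars I P) = eval w P := by
  rw [onVars, map_sum, eval_eq, Finset.sum_filter]
  refine Finset.sum_congr rfl fun d _ => ?_
  split_ifs with hd
  · rw [eval_monomial, Finsupp.prod]
  · obtain ⟨i, hid, hiI⟩ := Finset.not_subset.1 hd
    rw [Finset.prod_eq_zero hid, mul_zero]
    rw [hw i hiI, zero_pow (Finsupp.mem_support_iff.1 hid)]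

theorem onVars_mem_hom {n : ℕ} {m : ℤ} (I : Finset (Fin (n + 1)))
    {P : MvPolynomial (Fin (n + 1)) ℝ} (hP : P ∈ hom n m) : onVars I P ∈ hom n m := by
  rw [mem_hom_iff] at hP ⊢
  intro d hd
  rw [coeff_onVars] at hd
  exact hP d fun h => hd (by simp [h])

/-- A homogeneous polynomial in the barycentric coordinates that vanishes on a face has no
monomials in the variables of that face only. -/
theorem coeff_eq_zero_of_vanish {n : ℕ} (s : Splx n) {m : ℤ} {I : Finset (Fin (n + 1))}
    {P : MvPolynomial (Fin (n + 1)) ℝ} (hP : P ∈ hom n m) (hI : m ≠ 0 ∨ I.Nonempty)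
    (h : ∀ x ∈ face s I, eval (fun i => bary s i x) P = 0) {d : Fin (n + 1) →₀ ℕ}
    (hd : d.support ⊆ I) : coeff d P = 0 := by
  -- The empty face imposes no condition. Only the constant monomial has empty support, and $m\neq0$
  -- excludes it.
  rcases I.eq_empty_or_nonempty with rfl | hne
  · by_contra hc
    have h1 := mem_hom_iff.1 hP d hc
    have h2 : d = 0 := by simpa using hd
    rw [h2] at h1
    simp at h1 hI
    exact hI h1.symm
  suffices h0 : onVars I P = 0 by
    have := coeff_onVars I P d
    rw [h0, if_pos hd] at this
    simpa using this.symm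
  have hm : onVars I P ∈ hom n m := onVars_mem_hom I hP
  -- It is enough to vanish on the positive orthant. Rescaling the entries in $I$ to sum $1$ gives a
  -- point of the face, and by homogeneity this only multiplies the value by a nonzero power.
  refine MvPolynomial.funext_set (fun _ => Set.Ioi (0 : ℝ)) (fun _ => Set.Ioi_infinite 0)
    fun w hw => ?_
  have hw : ∀ i, 0 < w i := fun i => hw i trivial
  set W := ∑ i ∈ I, w i with hW
  have hWpos : 0 < W := Finset.sum_pos (fun i _ => hw i) hne
  obtain ⟨x, hx⟩ := exists_bary_eq s (fun i => if i ∈ I then W⁻¹ * w i else 0) (by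
    rw [Finset.sum_ite_mem, Finset.univ_inter, ← Finset.mul_sum, ← hW, inv_mul_cancel₀ hWpos.ne'])
  have hxI : x ∈ face s I := by
    rw [mem_face_iff]
    refine ⟨fun i => ?_, fun i hi => by simp [hx, hi]⟩
    rw [hx]
    split_ifs
    · have := hw i
      positivity
    · exact le_rfl
  have h1 := h x hxI
  rw [← eval_onVars P ((mem_face_iff s I x).1 hxI).2] at h1
  have h2 : eval (fun i => bary s i x) (onVars I P) = W⁻¹ ^ m.toNat * eval w (onVars I P) := by
    rw [eval_eq, eval_eq, Finset.mul_sum]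
    refine Finset.sum_congr rfl fun e he => ?_
    have he := mem_support_iff.1 he
    have hem := mem_hom_iff.1 hm e he
    have hes : e.support ⊆ I := by
      by_contra hc
      rw [coeff_onVars, if_neg hc] at he
      exact he rfl
    have hdeg : m.toNat = ∑ i ∈ e.support, e i := by
      rw [← hem]
      rfl
    rw [hdeg, ← Finset.prod_pow_eq_pow_sum, mul_left_comm, ← Finset.prod_mul_distrib]
    congr 1
    refine Finset.prod_congr rfl fun i hi => ?_
    rw [hx, if_pos (hes hi), mul_pow]
  rw [h2] at h1
  rw [map_zero]
  exact (mul_eq_zero.1 h1).resolve_left (by positivity)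

/-- A polynomial of positive degree on a face that vanishes on some facets of the face is divisible
by the barycentric coordinates defining these facets. -/
theorem exists_eq_prod_bary_mul {n : ℕ} (s : Splx n) {m : ℕ} (hm : m ≠ 0)
    {I J : Finset (Fin (n + 1))} {P : MvPolynomial (Fin (n + 1)) ℝ}
    (hP : P ∈ hom n m)
    (h : ∀ j ∈ J, ∀ x ∈ face s (I.erase j), eval (fun i => bary s i x) P = 0) :
    ∃ Q ∈ hom n (m - J.card), ∀ x ∈ face s I,
      eval (fun i => bary s i x) P = (∏ j ∈ J, bary s j x) * eval (fun i => bary s i x) Q := by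
  set e : Fin (n + 1) →₀ ℕ := ∑ j ∈ J, Finsupp.single j 1 with he
  have hei : ∀ i, e i = if i ∈ J then 1 else 0 := fun i => by
    simp [he, Finsupp.finsetSum_apply, Finsupp.single_apply]
  have hedeg : e.degree = J.card := by
    simp [he, map_sum]
  -- A monomial that lacks the variable $j\in J$ lives on the facet of `I.erase j`, where $P$
  -- vanishes, so its coefficient is zero.
  have hdvd : ∀ d, coeff d (onVars I P) ≠ 0 → e ≤ d := by
    intro d hd i
    rw [hei]
    split_ifs with hi
    · rw [Nat.one_le_iff_ne_zero]
      intro hdi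
      rw [coeff_onVars] at hd
      have hdI : d.support ⊆ I := by
        by_contra hc
        simp [hc] at hd
      rw [if_pos hdI] at hd
      -- If $I$ is a vertex, `I.erase i` can be empty; this is where $m\neq0$ is needed.
      refine hd (coeff_eq_zero_of_vanish s hP (Or.inl (by exact_mod_cast hm)) (h i hi) ?_)
      rw [Finset.subset_erase]
      exact ⟨hdI, by simpa using hdi⟩
    · exact Nat.zero_le _
  refine ⟨(onVars I P).divMonomial e, ?_, fun x hx => ?_⟩
  · rw [mem_hom_iff]
    intro d hd
    rw [coeff_divMonomial] at hd
    have := mem_hom_iff.1 (onVars_mem_hom I hP) _ hd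
    rw [map_add, hedeg] at this
    push_cast at this
    omega
  · have hQ : monomial e 1 * (onVars I P).divMonomial e = onVars I P := by
      ext d
      rw [coeff_monomial_mul']
      split_ifs with hed
      · rw [coeff_divMonomial, one_mul, add_tsub_cancel_of_le hed]
      · by_contra hc
        exact hed (hdvd d (Ne.symm hc))
    rw [← eval_onVars P ((mem_face_iff s I x).1 hx).2, ← hQ, map_mul, hQ, eval_monomial, one_mul]
    congr 1
    rw [Finsupp.prod_fintype _ _ (by simp), ← Finset.prod_subset (Finset.subset_univ J)]
    · refine Finset.prod_congr rfl fun i hi => ?_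
      rw [hei, if_pos hi, pow_one]
    · intro i _ hi
      rw [hei, if_neg hi, pow_zero]

/-! ### Dimensions of polynomial spaces -/

/-- Polynomials on a face are the polynomials in the barycentric coordinates of its vertices. -/
def polyOnFaceEquiv {n : ℕ} (s : Splx n) (m : ℤ) {I : Finset (Fin (n + 1))} (hI : I.Nonempty) :
    restrictSupport ℝ {d : Fin (n + 1) →₀ ℕ | (d.degree : ℤ) = m ∧ d.support ⊆ I} ≃ₗ[ℝ]
      polyOn m (face s I) :=
  LinearEquiv.ofBijective
    ((baryEval s (face s I)).restrict fun P hP => by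
      rw [polyOn_eq_map s]
      exact ⟨P, fun d hd => (hP hd).1, rfl⟩) <| by
    constructor
    · rw [← LinearMap.ker_eq_bot, LinearMap.ker_eq_bot']
      rintro ⟨P, hP⟩ h
      have hPm : P ∈ hom n m := fun d hd => (hP hd).1
      have h0 : ∀ x ∈ face s I, eval (fun i => bary s i x) P = 0 := fun x hx => by
        have := congrFun (congrArg Subtype.val h) ⟨x, hx⟩
        rw [← baryEval_apply s (face s I) P ⟨x, hx⟩]
        exact this
      ext d
      by_contra hd
      have hd' : d ∈ P.support := mem_support_iff.2 fun h => hd (by simp [h])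
      exact mem_support_iff.1 hd' (coeff_eq_zero_of_vanish s hPm (Or.inr hI) h0 (hP hd').2)
    · rintro ⟨f, hf⟩
      obtain ⟨P, hP, hPf⟩ := (mem_polyOn_iff s).1 hf
      refine ⟨⟨onVars I P, fun d hd => ?_⟩, ?_⟩
      · have hd : coeff d (onVars I P) ≠ 0 := mem_support_iff.1 hd
        refine ⟨mem_hom_iff.1 (onVars_mem_hom I hP) d hd, ?_⟩
        by_contra hc
        rw [coeff_onVars, if_neg hc] at hd
        exact hd rfl
      · ext x
        change baryEval s (face s I) (onVars I P) x = f x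
        rw [baryEval_apply, eval_onVars P ((mem_face_iff s I _).1 x.2).2, hPf]

theorem setOf_degree_eq {n : ℕ} (m : ℕ) (I : Finset (Fin (n + 1))) :
    {d : Fin (n + 1) →₀ ℕ | (d.degree : ℤ) = m ∧ d.support ⊆ I} = I.finsuppAntidiag m := by
  ext d
  simp only [Set.mem_ofPred_eq, Finset.mem_coe, Finset.mem_finsuppAntidiag, Nat.cast_inj]
  refine and_congr_left fun hd => ?_
  rw [Finsupp.degree_apply, Finset.sum_subset hd fun i _ hi => by simpa using hi]

theorem setOf_degree_eq_empty {n : ℕ} {m : ℤ} (hm : m < 0) (I : Finset (Fin (n + 1))) :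
    {d : Fin (n + 1) →₀ ℕ | (d.degree : ℤ) = m ∧ d.support ⊆ I} = ∅ := by
  ext d
  simp only [Set.mem_ofPred_eq, Set.mem_empty_iff_false, iff_false, not_and]
  omega

theorem finite_setOf_degree_eq {n : ℕ} (m : ℤ) (I : Finset (Fin (n + 1))) :
    {d : Fin (n + 1) →₀ ℕ | (d.degree : ℤ) = m ∧ d.support ⊆ I}.Finite := by
  rcases lt_or_ge m 0 with hm | hm
  · rw [setOf_degree_eq_empty hm]
    exact Set.finite_empty
  · obtain ⟨m, rfl⟩ := Int.eq_ofNat_of_zero_le hm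
    rw [setOf_degree_eq]
    exact Finset.finite_toSet _

theorem finite_polyOn_face {n : ℕ} (s : Splx n) (m : ℤ) {I : Finset (Fin (n + 1))}
    (hI : I.Nonempty) : Module.Finite ℝ (polyOn m (face s I)) := by
  have := (finite_setOf_degree_eq m I).to_subtype
  have := Module.Finite.of_basis (basisRestrictSupport ℝ
    {d : Fin (n + 1) →₀ ℕ | (d.degree : ℤ) = m ∧ d.support ⊆ I})
  exact Module.Finite.equiv (polyOnFaceEquiv s m hI)

theorem finrank_polyOn_face {n : ℕ} (s : Splx n) (m : ℕ) {I : Finset (Fin (n + 1))} {ℓ : ℕ}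
    (hI : I.card = ℓ + 1) : Module.finrank ℝ (polyOn m (face s I)) = (m + ℓ).choose ℓ := by
  have hne : I.Nonempty := Finset.card_pos.1 (by omega)
  rw [← (polyOnFaceEquiv s m hne).finrank_eq,
    Module.finrank_eq_nat_card_basis (basisRestrictSupport ℝ _), setOf_degree_eq]
  rw [Nat.card_coe_set_eq, Set.ncard_coe_finset, Finset.card_finsuppAntidiag_nat_eq_choose, hI,
    show ℓ + 1 + m - 1 = m + ℓ by omega, Nat.choose_symm_add]

theorem finrank_polyOn_face_of_neg {n : ℕ} (s : Splx n) {m : ℤ} (hm : m < 0)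
    {I : Finset (Fin (n + 1))} (hI : I.Nonempty) :
    Module.finrank ℝ (polyOn m (face s I)) = 0 := by
  rw [← (polyOnFaceEquiv s m hI).finrank_eq,
    Module.finrank_eq_nat_card_basis (basisRestrictSupport ℝ _), setOf_degree_eq_empty hm]
  simp

/-- `dim P_{k-ℓ-1}(F)` for an `ℓ`-dimensional face `F`. -/
theorem finrank_polyOn_face_sub {n : ℕ} (s : Splx n) {k ℓ : ℕ} (hk : 1 ≤ k)
    {I : Finset (Fin (n + 1))} (hI : I.card = ℓ + 1) :
    Module.finrank ℝ (polyOn ((k : ℤ) - ℓ - 1) (face s I)) = (k - 1).choose ℓ := by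
  rcases lt_or_ge (k - 1) ℓ with h | h
  · rw [Nat.choose_eq_zero_of_lt h,
      finrank_polyOn_face_of_neg s (by omega) (Finset.card_pos.1 (by omega))]
  · obtain ⟨m, hm⟩ := Nat.exists_eq_add_of_le h
    rw [show (k : ℤ) - ℓ - 1 = (m : ℕ) by omega, finrank_polyOn_face s m hI, hm, add_comm]

theorem finite_polyOn_body {n : ℕ} (s : Splx n) (m : ℤ) : Module.Finite ℝ (polyOn m (body s)) :=
  face_univ s ▸ finite_polyOn_face s m Finset.univ_nonempty

theorem finrank_polyOn_body {n : ℕ} (s : Splx n) (m : ℕ) :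
    Module.finrank ℝ (polyOn m (body s)) = (n + m).choose n := by
  rw [← face_univ, finrank_polyOn_face s m (ℓ := n) (by simp), add_comm]

theorem finrank_polyOn_body_sub_two {n : ℕ} (s : Splx n) {k : ℕ} (hn : 1 ≤ n) (hk : 1 ≤ k) :
    Module.finrank ℝ (polyOn ((k : ℤ) - 2) (body s)) = (n + k - 2).choose n := by
  rcases Nat.lt_or_ge k 2 with h | h
  -- For $k=1$ the upper index is $n-1<n$; with $n=0$ truncated subtraction would give $\binom00=1$
  -- instead of $0$.
  · rw [← face_univ, finrank_polyOn_face_of_neg s (by omega) Finset.univ_nonempty,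
      Nat.choose_eq_zero_of_lt (by omega)]
  · obtain ⟨m, rfl⟩ := Nat.exists_eq_add_of_le h
    rw [show ((2 + m : ℕ) : ℤ) - 2 = (m : ℕ) by push_cast; ring, finrank_polyOn_body]
    congr 1
    omega

/-! ### Volume on faces -/

section Measure

/-- The preimage of a face in the space of its tangential vectors has interior points. -/
theorem interior_preimage_face_nonempty {n : ℕ} (s : Splx n) {I : Finset (Fin (n + 1))}
    {i₀ : Fin (n + 1)} (hi₀ : i₀ ∈ I) :
    (interior {v : vectorSpan ℝ (s.points '' (I : Set (Fin (n + 1)))) |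
      (v : E n) + s.points i₀ ∈ face s I}).Nonempty := by
  set V := vectorSpan ℝ (s.points '' (I : Set (Fin (n + 1)))) with hV
  let v : I → V := fun i => ⟨s.points i - s.points i₀,
    vsub_mem_vectorSpan ℝ ⟨i, i.2, rfl⟩ ⟨i₀, hi₀, rfl⟩⟩
  let φ : V →ᵃ[ℝ] E n := V.subtype.toAffineMap + AffineMap.const ℝ V (s.points i₀)
  have hφ : ∀ w, φ w = (w : E n) + s.points i₀ := fun w => rfl
  have hind : AffineIndependent ℝ v := by
    refine AffineIndependent.of_comp φ ?_
    have : φ ∘ v = fun i : I => s.points i := by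
      ext1 i
      simp [hφ, v]
    rw [this]
    exact s.independent.comp_embedding (Function.Embedding.subtype _)
  have hrank : Module.finrank ℝ V + 1 = Fintype.card I := by
    have h1 : AffineIndependent ℝ fun i : I => s.points i :=
      s.independent.comp_embedding (Function.Embedding.subtype _)
    have h2 : s.points '' (I : Set (Fin (n + 1))) = Set.range fun i : I => s.points i := by
      ext
      simp
    have : Nonempty I := ⟨⟨i₀, hi₀⟩⟩
    rw [hV, h2]
    exact h1.finrank_vectorSpan_add_one
  -- The translated vertices are affinely independent and number $\dim V+1$, so their hull has
  -- interior in $V$.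
  have hspan : affineSpan ℝ (Set.range v) = ⊤ :=
    hind.affineSpan_eq_top_iff_card_eq_finrank_add_one.2 hrank.symm
  refine (interior_convexHull_nonempty_iff_affineSpan_eq_top.2 hspan).mono (interior_mono ?_)
  refine convexHull_min ?_ ((convex_convexHull ℝ _).affine_preimage φ)
  rintro _ ⟨i, rfl⟩
  refine subset_convexHull ℝ _ ⟨i, i.2, ?_⟩
  simp [v]

theorem finrank_vectorSpan_face {n : ℕ} (s : Splx n) {ℓ : ℕ} {I : Finset (Fin (n + 1))}
    (hI : I.card = ℓ + 1) :
    Module.finrank ℝ (vectorSpan ℝ (s.points '' (I : Set (Fin (n + 1))))) = ℓ := by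
  have h1 : AffineIndependent ℝ fun i : I => s.points i :=
    s.independent.comp_embedding (Function.Embedding.subtype _)
  have h2 : s.points '' (I : Set (Fin (n + 1))) = Set.range fun i : I => s.points i := by
    ext
    simp
  rw [h2]
  exact h1.finrank_vectorSpan (by simpa using hI)

/-- A relatively open nonempty subset of a convex set with interior points has interior points. -/
theorem measure_inter_pos {V : Type*} [NormedAddCommGroup V] [NormedSpace ℝ V] [MeasurableSpace V]
    (μ : Measure V) [μ.IsOpenPosMeasure] {T O : Set V} (hT : Convex ℝ T)
    (hint : (interior T).Nonempty) (hO : IsOpen O) (hne : (O ∩ T).Nonempty) : μ (O ∩ T) ≠ 0 := by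
  obtain ⟨x, hxO, hxT⟩ := hne
  have hx : x ∈ closure (interior T) := by
    rw [hT.closure_interior_eq_closure_of_nonempty_interior hint]
    exact subset_closure hxT
  have hne' : (O ∩ interior T).Nonempty := mem_closure_iff.1 hx O hO hxO
  have hpos := (hO.inter isOpen_interior).measure_pos μ hne'
  exact (hpos.trans_le (measure_mono (Set.inter_subset_inter_right O interior_subset))).ne'

theorem isometry_add_point {n : ℕ} (V : Submodule ℝ (E n)) (p : E n) :
    Isometry fun v : V => (v : E n) + p :=
  Isometry.of_dist_eq fun x y => by simp [Subtype.dist_eq]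

/-- Translation by a vertex is an isometry from the tangent space onto the affine hull of the face.
Finiteness and positivity on open sets can thus be checked in a space whose dimension equals that of
the measure. -/
theorem euclideanHausdorffMeasure_face {n : ℕ} (s : Splx n) {ℓ : ℕ} {I : Finset (Fin (n + 1))}
    {i₀ : Fin (n + 1)} (hi₀ : i₀ ∈ I) (A : Set (face s I)) :
    (Measure.euclideanHausdorffMeasure ℓ : Measure (face s I)) A =
      (Measure.euclideanHausdorffMeasure ℓ :
        Measure (vectorSpan ℝ (s.points '' (I : Set (Fin (n + 1))))))
      {v | (v : E n) + s.points i₀ ∈ Subtype.val '' A} := by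
  have h1 := (isometry_add_point (vectorSpan ℝ (s.points '' (I : Set (Fin (n + 1)))))
    (s.points i₀)).euclideanHausdorffMeasure_preimage (d := ℓ) (Subtype.val '' A)
  have h2 := (isometry_subtype_coe (s := face s I)).euclideanHausdorffMeasure_image (d := ℓ) A
  rw [← h2]
  refine Eq.trans ?_ h1.symm
  congr 1
  refine (Set.inter_eq_left.2 ?_).symm
  rintro _ ⟨x, -, rfl⟩
  have hx : x.1 ∈ affineSpan ℝ (s.points '' (I : Set (Fin (n + 1)))) :=
    convexHull_subset_affineSpan _ x.2
  have hp : s.points i₀ ∈ affineSpan ℝ (s.points '' (I : Set (Fin (n + 1)))) :=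
    subset_affineSpan ℝ _ ⟨i₀, hi₀, rfl⟩
  refine ⟨⟨x.1 - s.points i₀, ?_⟩, by simp⟩
  rw [← direction_affineSpan]
  exact AffineSubspace.vsub_mem_direction hx hp

theorem convex_preimage_face {n : ℕ} (s : Splx n) (I : Finset (Fin (n + 1))) (V : Submodule ℝ (E n))
    (p : E n) : Convex ℝ {v : V | (v : E n) + p ∈ face s I} :=
  (convex_convexHull ℝ _).affine_preimage (V.subtype.toAffineMap + AffineMap.const ℝ V p)

theorem isFiniteMeasure_face {n : ℕ} (s : Splx n) {ℓ : ℕ} {I : Finset (Fin (n + 1))}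
    (hI : I.card = ℓ + 1) :
    IsFiniteMeasure (Measure.euclideanHausdorffMeasure ℓ : Measure (face s I)) := by
  obtain ⟨i₀, hi₀⟩ : I.Nonempty := Finset.card_pos.1 (by omega)
  constructor
  rw [euclideanHausdorffMeasure_face s hi₀]
  set V := vectorSpan ℝ (s.points '' (I : Set (Fin (n + 1)))) with hV
  have hℓ : ℓ = Module.finrank ℝ V := (finrank_vectorSpan_face s hI).symm
  rw [hℓ]
  refine IsCompact.measure_lt_top ?_
  have := (isometry_add_point V (s.points i₀)).isClosedEmbedding.isCompact_preimage
    (isCompact_face s I)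
  rwa [Set.image_univ, Subtype.range_coe]

theorem isOpenPosMeasure_face {n : ℕ} (s : Splx n) {ℓ : ℕ} {I : Finset (Fin (n + 1))}
    (hI : I.card = ℓ + 1) :
    (Measure.euclideanHausdorffMeasure ℓ : Measure (face s I)).IsOpenPosMeasure := by
  obtain ⟨i₀, hi₀⟩ : I.Nonempty := Finset.card_pos.1 (by omega)
  constructor
  rintro _ ⟨O, hO, rfl⟩ ⟨x, hx⟩
  rw [euclideanHausdorffMeasure_face s hi₀]
  have hint := interior_preimage_face_nonempty s hi₀
  have hxV : x.1 - s.points i₀ ∈ vectorSpan ℝ (s.points '' (I : Set (Fin (n + 1)))) := by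
    rw [← direction_affineSpan]
    exact AffineSubspace.vsub_mem_direction (convexHull_subset_affineSpan _ x.2)
      (subset_affineSpan ℝ _ ⟨i₀, hi₀, rfl⟩)
  have hℓ := (finrank_vectorSpan_face s hI).symm
  set V := vectorSpan ℝ (s.points '' (I : Set (Fin (n + 1)))) with hV
  rw [hℓ]
  have hO' : IsOpen ((fun v : V => (v : E n) + s.points i₀) ⁻¹' O) :=
    hO.preimage (isometry_add_point V (s.points i₀)).continuous
  convert measure_inter_pos (Measure.euclideanHausdorffMeasure (Module.finrank ℝ V) : Measure V)
    (convex_preimage_face s I V (s.points i₀)) hint hO'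
    ⟨⟨x.1 - s.points i₀, hxV⟩, by simpa using hx, by simp⟩ using 2
  ext v
  simp [and_comm]

theorem interior_body_nonempty {n : ℕ} (s : Splx n) : (interior (body s)).Nonempty :=
  interior_convexHull_nonempty_iff_affineSpan_eq_top.2 (s.span_eq_top finrank_euclideanSpace_fin)

theorem volume_comap_body_apply {n : ℕ} (s : Splx n) (A : Set (body s)) :
    ((volume : Measure (E n)).comap Subtype.val : Measure (body s)) A =
      volume (Subtype.val '' A : Set (E n)) :=
  (MeasurableEmbedding.subtype_coe (isCompact_body s).measurableSet).comap_apply _ _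

instance isFiniteMeasure_body {n : ℕ} (s : Splx n) :
    IsFiniteMeasure ((volume : Measure (E n)).comap Subtype.val : Measure (body s)) := by
  constructor
  rw [volume_comap_body_apply]
  simpa using (isCompact_body s).measure_lt_top

instance isOpenPosMeasure_body {n : ℕ} (s : Splx n) :
    ((volume : Measure (E n)).comap Subtype.val : Measure (body s)).IsOpenPosMeasure := by
  constructor
  rintro _ ⟨O, hO, rfl⟩ ⟨x, hx⟩
  rw [volume_comap_body_apply, Subtype.image_preimage_coe, Set.inter_comm]
  exact measure_inter_pos volume (convex_convexHull ℝ _) (interior_body_nonempty s) hO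
    ⟨x, hx, x.2⟩

end Measure

/-! ### Integrals of continuous functions on compact spaces -/

section Pairing

variable {X : Type*} [TopologicalSpace X] [CompactSpace X] [MeasurableSpace X] [BorelSpace X]
  (μ : Measure X) [IsFiniteMeasure μ]

theorem integrable_of_continuous {f : X → ℝ} (hf : Continuous f) : Integrable f μ :=
  hf.integrable_of_hasCompactSupport (HasCompactSupport.of_compactSpace f)

/-- The pairing `(f, g) ↦ ⨍ f g` of two spaces of continuous functions. -/
def averagePairing (A B : Submodule ℝ (X → ℝ)) (hA : ∀ f ∈ A, Continuous f)
    (hB : ∀ f ∈ B, Continuous f) : A →ₗ[ℝ] B →ₗ[ℝ] ℝ :=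
  have hint : ∀ (f : A) (g : B), Integrable (fun x => f.1 x * g.1 x) μ := fun f g =>
    integrable_of_continuous μ ((hA _ f.2).mul (hB _ g.2))
  LinearMap.mk₂ ℝ (fun f g => ⨍ x, f.1 x * g.1 x ∂μ)
    (fun f f' g => by
      simp only [average_eq, ← smul_add]
      rw [← integral_add (hint _ _) (hint _ _)]
      simp [add_mul])
    (fun c f g => by
      simp only [average_eq]
      rw [smul_comm c, ← integral_smul]
      simp [mul_assoc, integral_const_mul])
    (fun f g g' => by
      simp only [average_eq, ← smul_add]
      rw [← integral_add (hint _ _) (hint _ _)]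
      simp [mul_add])
    (fun c f g => by
      simp only [average_eq]
      rw [smul_comm c, ← integral_smul]
      simp [mul_left_comm, integral_const_mul])

theorem eq_zero_of_integral_eq_zero [μ.IsOpenPosMeasure] {f : X → ℝ} (hf : Continuous f)
    (h0 : 0 ≤ f) (h : ∫ x, f x ∂μ = 0) (x : X) : f x = 0 := by
  by_contra hx
  exact (hf.integral_pos_of_hasCompactSupport_nonneg_nonzero (HasCompactSupport.of_compactSpace f)
    h0 hx).ne' h

theorem eq_zero_of_average_eq_zero [μ.IsOpenPosMeasure] {f : X → ℝ} (hf : Continuous f)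
    (h0 : 0 ≤ f) (h : ⨍ x, f x ∂μ = 0) (x : X) : f x = 0 := by
  have : Nonempty X := ⟨x⟩
  rw [average_eq, smul_eq_zero] at h
  refine eq_zero_of_integral_eq_zero μ hf h0 (h.resolve_left ?_) x
  rw [inv_eq_zero, measureReal_eq_zero_iff]
  exact isOpen_univ.measure_ne_zero μ Set.univ_nonempty

end Pairing

/-! ### Gradients of barycentric coordinates and edge tensors -/

section EdgeTensor

variable {n : ℕ} (s : Splx n)

/-- The gradient of the barycentric coordinate `λ_m`. -/
def grad (m : Fin (n + 1)) : Fin n → ℝ :=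
  fun c => ((vertexBasis s).coord m).linear (EuclideanSpace.single c 1)

theorem grad_dotProduct (m : Fin (n + 1)) (v : E n) :
    grad s m ⬝ᵥ v.ofLp = ((vertexBasis s).coord m).linear v := by
  have hv : v = ∑ c, v c • EuclideanSpace.single c (1 : ℝ) := by
    ext c
    simp [Finset.sum_apply, Pi.single_apply]
  conv_rhs => rw [hv, map_sum]
  simp [grad, dotProduct, mul_comm]

theorem grad_dotProduct_sub (m : Fin (n + 1)) (x y : E n) :
    grad s m ⬝ᵥ (x - y).ofLp = bary s m x - bary s m y := by
  rw [grad_dotProduct]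
  exact ((vertexBasis s).coord m).linearMap_vsub x y

theorem sum_grad : ∑ m, grad s m = 0 := by
  ext c
  have h : ∀ m, grad s m c =
      bary s m (EuclideanSpace.single c 1) - bary s m 0 := fun m => by
    rw [← grad_dotProduct_sub]
    simp
  simp [h, sum_bary]

theorem eq_zero_of_grad_dotProduct {v : Fin n → ℝ} (h : ∀ m, grad s m ⬝ᵥ v = 0) : v = 0 := by
  have h1 : ∀ m, bary s m (WithLp.toLp 2 v) = bary s m 0 := fun m => by
    have := grad_dotProduct_sub s m (WithLp.toLp 2 v) 0
    rw [sub_zero] at this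
    rw [← sub_eq_zero, ← this]
    exact h m
  have h2 : WithLp.toLp 2 v = (0 : E n) := by
    rw [← sum_bary_smul s (WithLp.toLp 2 v), ← sum_bary_smul s 0]
    simp only [h1]
  simpa using h2

/-- Because $\sum_m\nabla\lambda_m=0$, the off-diagonal values determine the diagonal ones. As the
gradients span $\mathbb R^n$, they determine the symmetric matrix. -/
theorem eq_zero_of_grad_mulVec_grad {S : Matrix (Fin n) (Fin n) ℝ} (hS : S.IsSymm)
    (h : ∀ a b, a < b → grad s a ⬝ᵥ S *ᵥ grad s b = 0) : S = 0 := by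
  have hsymm : ∀ v w, v ⬝ᵥ S *ᵥ w = w ⬝ᵥ S *ᵥ v := fun v w => by
    rw [Matrix.dotProduct_mulVec, ← Matrix.mulVec_transpose, hS.eq, dotProduct_comm]
  have hne : ∀ a b, a ≠ b → grad s a ⬝ᵥ S *ᵥ grad s b = 0 := fun a b hab => by
    rcases lt_or_gt_of_ne hab with hlt | hlt
    · exact h a b hlt
    · rw [hsymm]
      exact h b a hlt
  have hall : ∀ a b, grad s a ⬝ᵥ S *ᵥ grad s b = 0 := fun a b => by
    by_cases hab : a = b
    · subst hab
      have h0 : ∑ m, grad s m ⬝ᵥ S *ᵥ grad s a = 0 := by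
        rw [← sum_dotProduct, sum_grad, zero_dotProduct]
      rwa [Finset.sum_eq_single a (fun m _ hm => hne m a hm) (by simp)] at h0
    · exact hne a b hab
  have h1 : ∀ b, S *ᵥ grad s b = 0 := fun b => eq_zero_of_grad_dotProduct s fun a => hall a b
  have h2 : ∀ w, S *ᵥ w = 0 := fun w => eq_zero_of_grad_dotProduct s fun a => by
    rw [hsymm, h1, dotProduct_zero]
  ext i j
  have := congrFun (h2 (Pi.single j 1)) i
  simpa using this

theorem grad_edgeTensor_grad (i j a b : Fin (n + 1)) :
    grad s a ⬝ᵥ edgeTensor s i j *ᵥ grad s b =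
      ((if a = j then 1 else 0) - (if a = i then 1 else 0)) *
        ((if b = j then 1 else 0) - (if b = i then 1 else 0)) := by
  rw [edgeTensor, Matrix.vecMulVec_mulVec, dotProduct_smul, dotProduct_comm _ (grad s b),
    grad_dotProduct_sub, grad_dotProduct_sub]
  simp only [bary_point]
  simp

theorem isSymm_edgeTensor (i j : Fin (n + 1)) : (edgeTensor s i j).IsSymm :=
  Matrix.transpose_vecMulVec _ _

/-- The edges of an `n`-simplex. -/
abbrev Edge (n : ℕ) : Type := {p : Fin (n + 1) × Fin (n + 1) // p.1 < p.2}

/-- The matrix field `∑_{i<j} q_{ij} T_{ij}`. -/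
def edgeCombo (S : Set (E n)) : (Edge n → S → ℝ) →ₗ[ℝ] (S → Matrix (Fin n) (Fin n) ℝ) where
  toFun q x := ∑ p, q p x • edgeTensor s p.1.1 p.1.2
  map_add' q r := by
    ext1 x
    simp [add_smul, Finset.sum_add_distrib]
  map_smul' c q := by
    ext1 x
    simp [Finset.smul_sum, smul_smul]

/-- Duality of gradients and edges: $\nabla\lambda_a\cdot T_{i,j}\nabla\lambda_b$ with $a<b$ is
nonzero only if both $a$ and $b$ are endpoints of the edge, and then it equals $-1$. -/
theorem grad_edgeCombo_grad {S : Set (E n)} (q : Edge n → S → ℝ) (x : S) (p : Edge n) :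
    grad s p.1.1 ⬝ᵥ edgeCombo s S q x *ᵥ grad s p.1.2 = -q p x := by
  simp only [edgeCombo, LinearMap.coe_mk, AddHom.coe_mk, Matrix.sum_mulVec, dotProduct_sum,
    Matrix.smul_mulVec, dotProduct_smul, grad_edgeTensor_grad]
  rw [Finset.sum_eq_single p]
  · have h := p.2
    rw [if_neg h.ne, if_neg h.ne', if_pos rfl, if_pos rfl]
    simp
  · rintro r - hr
    have h : p.1.1 ≠ r.1.1 ∨ p.1.2 ≠ r.1.2 := by
      by_contra! hc
      exact hr (Subtype.ext (Prod.ext hc.1.symm hc.2.symm))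
    have h1 := p.2
    have h2 := r.2
    rw [smul_eq_mul]
    split_ifs <;> first | simp; done | (exfalso; omega)
  · simp

theorem edgeCombo_injective (S : Set (E n)) : Function.Injective (edgeCombo s S) := by
  intro q r h
  ext p x
  rw [← neg_inj, ← grad_edgeCombo_grad s q, h, grad_edgeCombo_grad]

theorem isSymm_edgeCombo {S : Set (E n)} (q : Edge n → S → ℝ) (x : S) :
    (edgeCombo s S q x).IsSymm := by
  change Matrix.transpose _ = _
  simp only [edgeCombo, LinearMap.coe_mk, AddHom.coe_mk, Matrix.transpose_sum,
    Matrix.transpose_smul, (isSymm_edgeTensor s _ _).eq]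

theorem edgeCombo_grad {S : Set (E n)} {τ : S → Matrix (Fin n) (Fin n) ℝ}
    (hτ : ∀ x, (τ x).IsSymm) :
    edgeCombo s S (fun p x => -(grad s p.1.1 ⬝ᵥ τ x *ᵥ grad s p.1.2)) = τ := by
  ext1 x
  rw [← sub_eq_zero]
  refine eq_zero_of_grad_mulVec_grad s ((isSymm_edgeCombo s _ x).sub (hτ x)) fun a b hab => ?_
  rw [Matrix.sub_mulVec, dotProduct_sub, grad_edgeCombo_grad s _ x ⟨(a, b), hab⟩]
  simp

end EdgeTensor

/-! ### Components of matrix fields -/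

theorem dotProduct_mulVec_mem_polyOn {n : ℕ} {m : ℤ} {S : Set (E n)}
    {τ : S → Matrix (Fin n) (Fin n) ℝ} (hτ : τ ∈ symPolyOn m S) (u v : Fin n → ℝ) :
    (fun x => u ⬝ᵥ τ x *ᵥ v) ∈ polyOn m S := by
  have h : (fun x => u ⬝ᵥ τ x *ᵥ v) = ∑ i, ∑ j, (u i * v j) • fun x => τ x i j := by
    ext x
    simp only [dotProduct, Matrix.mulVec, Finset.mul_sum, Finset.sum_apply, Pi.smul_apply,
      smul_eq_mul]
    refine Finset.sum_congr rfl fun i _ => Finset.sum_congr rfl fun j _ => by ring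
  rw [h]
  exact Submodule.sum_mem _ fun i _ => Submodule.sum_mem _ fun j _ =>
    Submodule.smul_mem _ _ (hτ.2 i j)

theorem comp_inclusion_mem_polyOn {n : ℕ} {m : ℤ} {S S' : Set (E n)} (h : S' ⊆ S) {f : S → ℝ}
    (hf : f ∈ polyOn m S) : f ∘ Set.inclusion h ∈ polyOn m S' := by
  obtain ⟨P, hP, rfl⟩ := hf
  exact ⟨P, hP, rfl⟩

/-- The component `uᵀ τ v` on a subset, as a linear function of the matrix field `τ`. -/
def component {n : ℕ} (m : ℤ) {S S' : Set (E n)} (h : S' ⊆ S) (u v : E n) :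
    symPolyOn m S →ₗ[ℝ] polyOn m S' where
  toFun τ := ⟨fun x => u.ofLp ⬝ᵥ τ.1 (Set.inclusion h x) *ᵥ v.ofLp,
    comp_inclusion_mem_polyOn h (dotProduct_mulVec_mem_polyOn τ.2 u.ofLp v.ofLp)⟩
  map_add' τ σ := by
    ext x
    simp [Matrix.add_mulVec]
  map_smul' c τ := by
    ext x
    simp [Matrix.smul_mulVec]

theorem continuous_apply_of_mem_symPolyOn {n : ℕ} {m : ℤ} {S : Set (E n)}
    {τ : S → Matrix (Fin n) (Fin n) ℝ} (hτ : τ ∈ symPolyOn m S) (i j : Fin n) :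
    Continuous fun x => τ x i j :=
  continuous_of_mem_polyOn (hτ.2 i j)

/-! ### Dimensions of spaces of matrix fields -/

/-- Every symmetric matrix field is a unique combination of the edge tensors. -/
def symPolyOnEquiv {n : ℕ} (s : Splx n) (m : ℤ) (S : Set (E n)) :
    (Edge n → polyOn m S) ≃ₗ[ℝ] symPolyOn m S :=
  LinearEquiv.ofBijective
    (((edgeCombo s S).comp (LinearMap.compLeft (polyOn m S).subtype (Edge n))).codRestrict
      (symPolyOn m S) fun q => by
        refine ⟨fun x => isSymm_edgeCombo s _ x, fun i j => ?_⟩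
        have h : (fun x => (edgeCombo s S fun p => (q p).1) x i j) =
            ∑ p, edgeTensor s p.1.1 p.1.2 i j • (q p).1 := by
          ext x
          simp [edgeCombo, Matrix.sum_apply, mul_comm]
        change (fun x => (edgeCombo s S fun p => (q p).1) x i j) ∈ _
        rw [h]
        exact Submodule.sum_mem _ fun p _ => Submodule.smul_mem _ _ (q p).2) <| by
    constructor
    · intro q r h
      have h' : edgeCombo s S (fun p => (q p).1) = edgeCombo s S (fun p => (r p).1) :=
        congrArg Subtype.val h
      ext1 p
      exact Subtype.ext (congrFun (edgeCombo_injective s S h') p)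
    · rintro ⟨τ, hτ⟩
      refine ⟨fun p => -⟨_, dotProduct_mulVec_mem_polyOn hτ (grad s p.1.1) (grad s p.1.2)⟩, ?_⟩
      exact Subtype.ext (edgeCombo_grad s hτ.1)

/-- The linear map `q ↦ ∑_{i<j} λ_i λ_j q_{ij} T_{ij}`. -/
def bubbleMap {n : ℕ} (s : Splx n) (m : ℤ) :
    (Edge n → polyOn m (body s)) →ₗ[ℝ] (body s → Matrix (Fin n) (Fin n) ℝ) :=
  (edgeCombo s (body s)).comp (LinearMap.pi fun p =>
    ((LinearMap.mulLeft ℝ fun x : body s => bary s p.1.1 x.1 * bary s p.1.2 x.1).comp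
      (polyOn m (body s)).subtype).comp (LinearMap.proj p))

theorem bubbleMap_apply {n : ℕ} (s : Splx n) (m : ℤ) (q : Edge n → polyOn m (body s)) :
    bubbleMap s m q = edgeCombo s (body s) fun p x =>
      bary s p.1.1 x.1 * bary s p.1.2 x.1 * (q p).1 x := rfl

/-- The product is represented by a homogeneous polynomial, which is zero once it vanishes on $K$;
the polynomial ring is a domain, so the factor $P$ is zero. -/
theorem eq_zero_of_bary_mul_eq_zero {n : ℕ} (s : Splx n) {m : ℤ} {f : body s → ℝ}
    (hf : f ∈ polyOn m (body s)) (a b : Fin (n + 1))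
    (h : ∀ x : body s, bary s a x.1 * bary s b x.1 * f x = 0) : f = 0 := by
  obtain ⟨P, hP, hPf⟩ := (mem_polyOn_iff s).1 hf
  have hX : MvPolynomial.X a * MvPolynomial.X b * P ∈ hom n (m + 2) := by
    rw [mem_hom_iff] at hP ⊢
    intro d hd
    rw [mul_assoc, MvPolynomial.coeff_X_mul', MvPolynomial.coeff_X_mul'] at hd
    split_ifs at hd with h1 h2
    · have h3 := hP _ hd
      have h4 : (Finsupp.single b 1 : Fin (n + 1) →₀ ℕ) ≤ d - Finsupp.single a 1 := by
        rw [Finsupp.single_le_iff]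
        exact Nat.one_le_iff_ne_zero.2 (Finsupp.mem_support_iff.1 h2)
      have h5 : (Finsupp.single a 1 : Fin (n + 1) →₀ ℕ) ≤ d := by
        rw [Finsupp.single_le_iff]
        exact Nat.one_le_iff_ne_zero.2 (Finsupp.mem_support_iff.1 h1)
      have h6 := congrArg Finsupp.degree (tsub_add_cancel_of_le h4)
      have h7 := congrArg Finsupp.degree (tsub_add_cancel_of_le h5)
      rw [map_add, Finsupp.degree_single] at h6 h7
      omega
    · exact absurd rfl hd
    · exact absurd rfl hd
  have h0 : MvPolynomial.X a * MvPolynomial.X b * P = 0 := by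
    ext d
    refine coeff_eq_zero_of_vanish s (I := Finset.univ) hX (Or.inr Finset.univ_nonempty)
      (fun x hx => ?_) (Finset.subset_univ _)
    rw [face_univ] at hx
    rw [map_mul, map_mul, MvPolynomial.eval_X, MvPolynomial.eval_X, ← hPf ⟨x, hx⟩]
    exact h ⟨x, hx⟩
  have hP0 : P = 0 := (mul_eq_zero.1 h0).resolve_left
    (mul_ne_zero (MvPolynomial.X_ne_zero a) (MvPolynomial.X_ne_zero b))
  ext x
  rw [hPf, hP0, map_zero, Pi.zero_apply]

theorem bubbleMap_injective {n : ℕ} (s : Splx n) (m : ℤ) : Function.Injective (bubbleMap s m) := by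
  rw [← LinearMap.ker_eq_bot, LinearMap.ker_eq_bot']
  intro q hq
  rw [bubbleMap_apply] at hq
  have h := edgeCombo_injective s (body s) (hq.trans (map_zero _).symm)
  ext1 p
  exact Subtype.ext (eq_zero_of_bary_mul_eq_zero s (q p).2 p.1.1 p.1.2 fun x =>
    congrFun (congrFun h p) x)

theorem range_bubbleMap {n : ℕ} (s : Splx n) (k : ℕ) :
    LinearMap.range (bubbleMap s ((k : ℤ) - 2)) = bubble s k := by
  apply le_antisymm
  · rintro _ ⟨q, rfl⟩
    rw [bubbleMap_apply]
    have h : (edgeCombo s (body s) fun p x => bary s p.1.1 x.1 * bary s p.1.2 x.1 * (q p).1 x) =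
        ∑ p : Edge n, fun x : body s =>
          (bary s p.1.1 x.1 * bary s p.1.2 x.1 * (q p).1 x) • edgeTensor s p.1.1 p.1.2 := by
      ext1 x
      simp [edgeCombo, Finset.sum_apply]
    rw [h]
    exact Submodule.sum_mem _ fun p _ =>
      Submodule.subset_span ⟨p.1.1, p.1.2, p.2, (q p).1, (q p).2, rfl⟩
  · rw [bubble, Submodule.span_le]
    rintro _ ⟨i, j, hij, q, hq, rfl⟩
    refine ⟨Pi.single ⟨(i, j), hij⟩ ⟨q, hq⟩, ?_⟩
    rw [bubbleMap_apply]
    ext1 x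
    simp only [edgeCombo, LinearMap.coe_mk, AddHom.coe_mk]
    rw [Finset.sum_eq_single ⟨(i, j), hij⟩]
    · simp
    · intro p _ hp
      simp [Pi.single_eq_of_ne hp]
    · simp

/-- The bubble space is the direct sum of the spaces `λ_i λ_j P_{k-2}(K) T_{i,j}`. -/
def bubbleEquiv {n : ℕ} (s : Splx n) (k : ℕ) :
    (Edge n → polyOn ((k : ℤ) - 2) (body s)) ≃ₗ[ℝ] bubble s k :=
  (LinearEquiv.ofInjective _ (bubbleMap_injective s _)).trans
    (LinearEquiv.ofEq _ _ (range_bubbleMap s k))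

theorem card_le_pairs (N : ℕ) :
    Fintype.card {p : Fin N × Fin N // p.1 ≤ p.2} = (N + 1).choose 2 := by
  rw [← Fintype.card_congr (Sym2.sortEquiv (α := Fin N)), Sym2.card, Fintype.card_fin]

theorem card_edge (n : ℕ) : Fintype.card (Edge n) = (n + 1) * n / 2 := by
  have h : Fintype.card {p : Fin n × Fin n // p.1 ≤ p.2} = Fintype.card (Edge n) := by
    -- The shift $(i,j)\mapsto(i,j+1)$ turns weak inequalities into strict ones.
    refine Fintype.card_of_bijective (f := fun p => ⟨(p.1.1.castSucc, p.1.2.succ),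
      Fin.castSucc_lt_succ_iff.2 p.2⟩) ⟨fun p q h => ?_, fun p => ?_⟩
    · have h := Prod.ext_iff.1 (Subtype.ext_iff.1 h)
      exact Subtype.ext (Prod.ext (Fin.castSucc_injective _ h.1) (Fin.succ_injective _ h.2))
    · obtain ⟨⟨i, j⟩, hij⟩ := p
      have hi : i ≠ Fin.last n := (hij.trans_le (Fin.le_last j)).ne
      have hj : j ≠ 0 := (hij.trans_le' (Fin.zero_le i)).ne'
      refine ⟨⟨(i.castPred hi, j.pred hj), ?_⟩, by simp⟩
      rw [← Fin.castSucc_lt_succ_iff]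
      simpa using hij
  rw [← h, card_le_pairs, Nat.choose_two_right, Nat.add_sub_cancel]

theorem finite_symPolyOn {n : ℕ} (s : Splx n) (m : ℤ) :
    Module.Finite ℝ (symPolyOn m (body s)) :=
  have := finite_polyOn_body s m
  Module.Finite.equiv (symPolyOnEquiv s m (body s))

theorem finrank_symPolyOn {n : ℕ} (s : Splx n) (m : ℕ) :
    Module.finrank ℝ (symPolyOn (m : ℤ) (body s)) = (n * (n + 1) / 2) * (n + m).choose n := by
  have := finite_polyOn_body s m
  rw [← (symPolyOnEquiv s m (body s)).finrank_eq, Module.finrank_pi_fintype]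
  simp only [finrank_polyOn_body, Finset.sum_const, Finset.card_univ, card_edge, smul_eq_mul,
    mul_comm]

theorem finite_bubble {n : ℕ} (s : Splx n) (k : ℕ) : Module.Finite ℝ (bubble s k) :=
  have := finite_polyOn_body s ((k : ℤ) - 2)
  Module.Finite.equiv (bubbleEquiv s k)

theorem finrank_bubble {n k : ℕ} (s : Splx n) (hn : 1 ≤ n) (hk : 1 ≤ k) :
    Module.finrank ℝ (bubble s k) = ((n + 1) * n / 2) * (n + k - 2).choose n := by
  have := finite_polyOn_body s ((k : ℤ) - 2)
  rw [← (bubbleEquiv s k).finrank_eq, Module.finrank_pi_fintype]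
  simp only [finrank_polyOn_body_sub_two s hn hk, Finset.sum_const, Finset.card_univ, card_edge,
    smul_eq_mul]

/-! ### Counting degrees of freedom -/

theorem choose_two_add_mul {n ℓ : ℕ} (h : ℓ ≤ n) :
    (n + 1 - ℓ).choose 2 + ℓ * (n - ℓ) = (n - ℓ) * (n + ℓ + 1) / 2 := by
  obtain ⟨r, rfl⟩ := Nat.exists_eq_add_of_le h
  have h1 : ℓ + r + 1 - ℓ = r + 1 := by omega
  rw [h1, Nat.add_sub_cancel_left, Nat.choose_two_right, Nat.add_sub_cancel]
  have h2 : r * (ℓ + r + ℓ + 1) = (r + 1) * r + (ℓ * r) * 2 := by ring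
  rw [h2, Nat.add_mul_div_right _ _ (by norm_num)]

theorem sum_choose_mul_choose (a b N : ℕ) :
    ∑ ℓ ∈ Finset.range (N + 1), a.choose (N - ℓ) * b.choose ℓ = (a + b).choose N := by
  rw [add_comm a b, Nat.add_choose_eq, Finset.Nat.sum_antidiagonal_eq_sum_range_succ_mk]
  exact Finset.sum_congr rfl fun ℓ _ => mul_comm _ _

theorem choose_mul_mul (n ℓ : ℕ) (hℓ : ℓ ≤ n) :
    (n + 1).choose (ℓ + 1) * (ℓ * (ℓ + 1)) = (n + 1) * n * (n - 1).choose (n - ℓ) := by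
  rcases ℓ with _ | ℓ
  · rcases n with _ | n
    · simp
    · simp
  · obtain ⟨n, rfl⟩ : ∃ r, n = r + 1 := ⟨n - 1, by omega⟩
    have h1 := Nat.add_one_mul_choose_eq (n + 1) (ℓ + 1)
    have h2 := Nat.add_one_mul_choose_eq n ℓ
    rw [Nat.add_sub_cancel, show n + 1 - (ℓ + 1) = n - ℓ by omega, Nat.choose_symm (by omega)]
    calc _ = ((n + 1 + 1).choose (ℓ + 1 + 1) * (ℓ + 1 + 1)) * (ℓ + 1) := by ring
      _ = (n + 1 + 1) * ((n + 1).choose (ℓ + 1) * (ℓ + 1)) := by rw [← h1]; ring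
      _ = _ := by rw [← h2]; ring

/-- From $(n-\ell)(n+\ell+1)=n(n+1)-\ell(\ell+1)$ the sum splits in two. After `choose_mul_mul`
absorbs $\ell(\ell+1)$, both parts are Vandermonde sums, and the subtracted one equals the bubble
term. Doubling and moving it to the other side avoids division and subtraction in `ℕ`. -/
theorem sum_dofs (n k : ℕ) (hn : 1 ≤ n) (hk : 1 ≤ k) :
    (∑ ℓ ∈ Finset.range n,
        (n + 1).choose (ℓ + 1) * (((n - ℓ) * (n + ℓ + 1) / 2) * (k - 1).choose ℓ)) +
      ((n + 1) * n / 2) * (n + k - 2).choose n = (n * (n + 1) / 2) * (n + k).choose n := by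
  have heven : ∀ ℓ ≤ n, 2 ∣ (n - ℓ) * (n + ℓ + 1) := fun ℓ hℓ => by
    obtain ⟨r, rfl⟩ := Nat.exists_eq_add_of_le hℓ
    rw [Nat.add_sub_cancel_left, show r * (ℓ + r + ℓ + 1) = r * (r + 1) + 2 * (r * ℓ) by ring]
    exact dvd_add (Nat.even_mul_succ_self r).two_dvd (Dvd.intro _ rfl)
  have hhalf : 2 * ((n + 1) * n / 2) = (n + 1) * n :=
    Nat.mul_div_cancel' (by simpa [mul_comm] using (Nat.even_mul_succ_self n).two_dvd)
  have hterm : ∀ ℓ ∈ Finset.range (n + 1),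
      2 * ((n + 1).choose (ℓ + 1) * (((n - ℓ) * (n + ℓ + 1) / 2) * (k - 1).choose ℓ)) +
        (n + 1) * n * ((n - 1).choose (n - ℓ) * (k - 1).choose ℓ) =
      (n + 1) * n * ((n + 1).choose (n - ℓ) * (k - 1).choose ℓ) := fun ℓ hℓ => by
    have hℓ : ℓ ≤ n := by simpa [Nat.lt_succ_iff] using hℓ
    have h1 := Nat.mul_div_cancel' (heven ℓ hℓ)
    have h2 := choose_mul_mul n ℓ hℓ
    have h3 : (n + 1).choose (n - ℓ) = (n + 1).choose (ℓ + 1) := by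
      rw [← Nat.choose_symm (show ℓ + 1 ≤ n + 1 by omega)]
      congr 1
      omega
    have h4 : (n - ℓ) * (n + ℓ + 1) + ℓ * (ℓ + 1) = (n + 1) * n := by
      obtain ⟨r, rfl⟩ := Nat.exists_eq_add_of_le hℓ
      rw [Nat.add_sub_cancel_left]
      ring
    rw [h3]
    calc _ = (n + 1).choose (ℓ + 1) * (2 * ((n - ℓ) * (n + ℓ + 1) / 2)) * (k - 1).choose ℓ +
          ((n + 1) * n * (n - 1).choose (n - ℓ)) * (k - 1).choose ℓ := by ring
      _ = (n + 1).choose (ℓ + 1) * ((n - ℓ) * (n + ℓ + 1) + ℓ * (ℓ + 1)) * (k - 1).choose ℓ := by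
          rw [h1, ← h2]; ring
      _ = _ := by rw [h4]; ring
  have hsum := Finset.sum_congr rfl hterm
  -- The Vandermonde range includes $\ell=n$, where the face term is zero because of the factor
  -- $n-\ell$.
  rw [Finset.sum_add_distrib, ← Finset.mul_sum, ← Finset.mul_sum, ← Finset.mul_sum,
    sum_choose_mul_choose, sum_choose_mul_choose, Finset.sum_range_succ] at hsum
  simp only [Nat.sub_self, zero_mul, Nat.zero_div, mul_zero, add_zero] at hsum
  rw [show n - 1 + (k - 1) = n + k - 2 by omega, show n + 1 + (k - 1) = n + k by omega,
    ← hhalf] at hsum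
  rw [mul_comm n (n + 1)]
  refine Nat.eq_of_mul_eq_mul_left (show 0 < 2 by norm_num) ?_
  rw [mul_add, ← mul_assoc 2 ((n + 1) * n / 2), ← mul_assoc 2 ((n + 1) * n / 2)]
  exact hsum

/-! ### The degrees of freedom as a linear map -/

instance {n ℓ : ℕ} (s : Splx n) (m : ℤ) (I : FaceIdx n ℓ) :
    Module.Finite ℝ (polyOn m (face s I.1)) :=
  finite_polyOn_face s m (Finset.card_pos.1 (by have := I.2; omega))

instance {n : ℕ} (s : Splx n) (k : ℕ) : Module.Finite ℝ (bubble s k) := finite_bubble s k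

instance {n : ℕ} (s : Splx n) (m : ℤ) : Module.Finite ℝ (symPolyOn m (body s)) :=
  finite_symPolyOn s m

/-- The moments of the component `uᵀ τ v` on a face. -/
def faceMoment {n : ℕ} (s : Splx n) (k : ℕ) {ℓ : ℕ} (I : FaceIdx n ℓ) (u v : E n) :
    symPolyOn (k : ℤ) (body s) →ₗ[ℝ] Module.Dual ℝ (polyOn ((k : ℤ) - ℓ - 1) (face s I.1)) :=
  have := isFiniteMeasure_face s I.2
  (averagePairing (Measure.euclideanHausdorffMeasure ℓ) (polyOn (k : ℤ) (face s I.1))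
    (polyOn ((k : ℤ) - ℓ - 1) (face s I.1)) (fun _ => continuous_of_mem_polyOn)
    (fun _ => continuous_of_mem_polyOn)).comp
    (component (k : ℤ) (face_subset_body s I.1) u v)

theorem continuous_apply_of_mem_bubble {n k : ℕ} {s : Splx n}
    {θ : body s → Matrix (Fin n) (Fin n) ℝ} (hθ : θ ∈ bubble s k) (i j : Fin n) :
    Continuous fun x => θ x i j := by
  induction hθ using Submodule.span_induction with
  | mem θ h =>
    obtain ⟨a, b, -, q, hq, rfl⟩ := h
    have h1 := (continuous_bary s a).comp (continuous_subtype_val (p := (· ∈ body s)))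
    have h2 := (continuous_bary s b).comp (continuous_subtype_val (p := (· ∈ body s)))
    exact ((h1.mul h2).mul (continuous_of_mem_polyOn hq)).mul continuous_const
  | zero => exact continuous_const
  | add θ θ' _ _ h h' => exact h.add h'
  | smul c θ _ h => exact h.const_smul c

/-- The interior moments of a matrix field. -/
def interiorMomentMap {n : ℕ} (s : Splx n) (k : ℕ) :
    symPolyOn (k : ℤ) (body s) →ₗ[ℝ] Module.Dual ℝ (bubble s k) :=
  have hint : ∀ (τ : symPolyOn (k : ℤ) (body s)) (θ : bubble s k),
      Integrable (fun x => ∑ i, ∑ j, τ.1 x i j * θ.1 x i j)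
        ((volume : Measure (E n)).comap Subtype.val) := fun τ θ =>
    integrable_of_continuous _ <| continuous_finsetSum _ fun i _ => continuous_finsetSum _ fun j _ =>
      (continuous_apply_of_mem_symPolyOn τ.2 i j).mul (continuous_apply_of_mem_bubble θ.2 i j)
  LinearMap.mk₂ ℝ (fun τ θ => interiorMoment s τ.1 θ.1)
    (fun τ τ' θ => by
      simp only [interiorMoment]
      rw [← integral_add (hint _ _) (hint _ _)]
      simp [add_mul, Finset.sum_add_distrib])
    (fun c τ θ => by
      simp only [interiorMoment]
      rw [← integral_smul]
      simp [mul_assoc, Finset.mul_sum])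
    (fun τ θ θ' => by
      simp only [interiorMoment]
      rw [← integral_add (hint _ _) (hint _ _)]
      simp [mul_add, Finset.sum_add_distrib])
    (fun c τ θ => by
      simp only [interiorMoment]
      rw [← integral_smul]
      simp [mul_left_comm, Finset.mul_sum])

/-- The map that sends a matrix field to the values of the degrees of freedom. -/
def dofMap {n : ℕ} (s : Splx n) (k : ℕ) (t : (ℓ : Fin n) → FaceIdx n ℓ → Fin ℓ → E n)
    (ν : (ℓ : Fin n) → FaceIdx n ℓ → Fin (n - ℓ) → E n) :
    symPolyOn (k : ℤ) (body s) →ₗ[ℝ] Dofs s k :=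
  LinearMap.prod
    (LinearMap.pi fun ℓ => LinearMap.pi fun I => LinearMap.prod
      (LinearMap.pi fun a => LinearMap.pi fun b => faceMoment s k I (t ℓ I a) (ν ℓ I b))
      (LinearMap.pi fun p => faceMoment s k I (ν ℓ I p.1.1) (ν ℓ I p.1.2)))
    (interiorMomentMap s k)

/-! ### Unisolvence -/

theorem face_mono {n : ℕ} (s : Splx n) {I J : Finset (Fin (n + 1))} (h : I ⊆ J) :
    face s I ⊆ face s J :=
  convexHull_mono (Set.image_mono (by exact_mod_cast h))

/-- A polynomial on a face that vanishes on the boundary of the face and whose moments vanish is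
zero. -/
theorem eq_zero_of_vanish_of_moments {n k ℓ : ℕ} (s : Splx n) (hk : 1 ≤ k)
    {I : Finset (Fin (n + 1))} (hI : I.card = ℓ + 1) {f : face s I → ℝ}
    (hf : f ∈ polyOn (k : ℤ) (face s I))
    (hvan : ∀ i ∈ I, ∀ x : face s I, x.1 ∈ face s (I.erase i) → f x = 0)
    (hmom : ∀ q ∈ polyOn ((k : ℤ) - ℓ - 1) (face s I),
      ⨍ x, f x * q x ∂(Measure.euclideanHausdorffMeasure ℓ) = 0) (x : face s I) : f x = 0 := by
  obtain ⟨P, hP, hPf⟩ := (mem_polyOn_iff s).1 hf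
  obtain ⟨Q, hQ, hPQ⟩ := exists_eq_prod_bary_mul s (by omega) (I := I) (J := I) hP
    fun j hj x hx => by
      rw [← hPf ⟨x, face_mono s (Finset.erase_subset j I) hx⟩]
      exact hvan j hj _ hx
  have hq : (fun x : face s I => MvPolynomial.eval (fun i => bary s i x.1) Q) ∈
      polyOn ((k : ℤ) - ℓ - 1) (face s I) := by
    refine (mem_polyOn_iff s).2 ⟨Q, ?_, fun x => rfl⟩
    rwa [hI, Nat.cast_succ, ← sub_sub] at hQ
  have := isFiniteMeasure_face s hI
  have := isOpenPosMeasure_face s hI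
  -- With the cofactor $Q$ as test function the integrand is $\bigl(\prod_{i\in
  -- I}\lambda_i\bigr)Q^2\ge0$.
  have hzero := eq_zero_of_average_eq_zero _ ((continuous_of_mem_polyOn hf).mul
    (continuous_of_mem_polyOn hq)) (fun y => by
      change 0 ≤ f y * _
      rw [hPf, hPQ y y.2, mul_assoc]
      exact mul_nonneg (Finset.prod_nonneg fun i _ => ((mem_face_iff s I _).1 y.2).1 i)
        (mul_self_nonneg _)) (hmom _ hq) x
  rw [hPf, hPQ x x.2]
  rcases mul_eq_zero.1 hzero with h | h
  · rw [← hPQ x x.2, ← hPf, h]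
  · change MvPolynomial.eval _ Q = 0 at h
    rw [h, mul_zero]

theorem dotProduct_ofLp_eq_inner {n : ℕ} (u v : E n) : u.ofLp ⬝ᵥ v.ofLp = inner ℝ u v := by
  rw [EuclideanSpace.inner_eq_star_dotProduct, star_trivial, dotProduct_comm]

theorem IsFrame.span_tangent {n : ℕ} {s : Splx n} {ℓ : ℕ} {I : FaceIdx n ℓ} {t : Fin ℓ → E n}
    {ν : Fin (n - ℓ) → E n} (h : IsFrame s I t ν) :
    Submodule.span ℝ (Set.range t) = vectorSpan ℝ (s.points '' (I.1 : Set (Fin (n + 1)))) := by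
  refine Submodule.eq_of_le_of_finrank_eq (Submodule.span_le.2 ?_) ?_
  · rintro _ ⟨a, rfl⟩
    exact h.tangent_mem a
  · rw [finrank_span_eq_card h.tangent_indep, finrank_vectorSpan_face s I.2, Fintype.card_fin]

theorem IsFrame.span_normal {n : ℕ} {s : Splx n} {ℓ : ℕ} {I : FaceIdx n ℓ} {t : Fin ℓ → E n}
    {ν : Fin (n - ℓ) → E n} (h : IsFrame s I t ν) :
    Submodule.span ℝ (Set.range ν) = (vectorSpan ℝ (s.points '' (I.1 : Set (Fin (n + 1)))))ᗮ := by
  refine Submodule.eq_of_le_of_finrank_eq (Submodule.span_le.2 ?_) ?_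
  · rintro _ ⟨a, rfl⟩
    exact h.normal_mem a
  · rw [finrank_span_eq_card h.normal_indep, Fintype.card_fin]
    have h1 := (vectorSpan ℝ (s.points '' (I.1 : Set (Fin (n + 1))))).finrank_add_finrank_orthogonal
    rw [finrank_vectorSpan_face s I.2, finrank_euclideanSpace_fin] at h1
    omega

theorem mem_orthogonal_of_span {n : ℕ} {ι : Type*} {V : Submodule ℝ (E n)} {v : ι → E n}
    (hV : Submodule.span ℝ (Set.range v) = V) {y : E n} (h : ∀ i, inner ℝ (v i) y = 0) :
    y ∈ Vᗮ := by
  rw [← hV, Submodule.mem_orthogonal]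
  intro u hu
  induction hu using Submodule.span_induction with
  | mem _ hx =>
    obtain ⟨i, rfl⟩ := hx
    exact h i
  | zero => exact inner_zero_left y
  | add a b _ _ ha hb => rw [inner_add_left, ha, hb, add_zero]
  | smul c a _ ha => rw [inner_smul_left, ha, mul_zero]

/-- Both families span by dimension, so $y$ lies in $V^\perp$ and is orthogonal to $V^\perp$. -/
theorem IsFrame.eq_zero {n : ℕ} {s : Splx n} {ℓ : ℕ} {I : FaceIdx n ℓ} {t : Fin ℓ → E n}
    {ν : Fin (n - ℓ) → E n} (h : IsFrame s I t ν) {y : E n} (ht : ∀ a, inner ℝ (t a) y = 0)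
    (hν : ∀ b, inner ℝ (ν b) y = 0) : y = 0 := by
  have h1 := mem_orthogonal_of_span h.span_tangent ht
  have h2 := mem_orthogonal_of_span h.span_normal hν
  exact inner_self_eq_zero.1 (Submodule.inner_right_of_mem_orthogonal h1 h2)

section Unisolvence

variable {n k : ℕ} {s : Splx n} {t : (ℓ : Fin n) → FaceIdx n ℓ → Fin ℓ → E n}
  {ν : (ℓ : Fin n) → FaceIdx n ℓ → Fin (n - ℓ) → E n}

/-- If the degrees of freedom on the faces vanish, then the normal components vanish on every
proper face. -/
theorem mulVec_normal_eq_zero (hk : 1 ≤ k) (hframe : ∀ ℓ I, IsFrame s I (t ℓ I) (ν ℓ I))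
    {τ : body s → Matrix (Fin n) (Fin n) ℝ} (hτ : τ ∈ symPolyOn (k : ℤ) (body s))
    (htn : ∀ (ℓ : Fin n) (I : FaceIdx n ℓ) a b,
      ∀ q ∈ polyOn ((k : ℤ) - (ℓ : ℕ) - 1) (face s I.1),
        meanMoment s I τ (t ℓ I a) (ν ℓ I b) q = 0)
    (hnn : ∀ (ℓ : Fin n) (I : FaceIdx n ℓ) b c, b ≤ c →
      ∀ q ∈ polyOn ((k : ℤ) - (ℓ : ℕ) - 1) (face s I.1),
        meanMoment s I τ (ν ℓ I b) (ν ℓ I c) q = 0)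
    (I : Finset (Fin (n + 1))) (hIn : I.card ≤ n) (x : E n) (hx : x ∈ face s I) (w : E n)
    (hw : w ∈ (vectorSpan ℝ (s.points '' (I : Set (Fin (n + 1)))))ᗮ) :
    τ ⟨x, face_subset_body s I hx⟩ *ᵥ w.ofLp = 0 := by
  induction I using Finset.strongInduction generalizing x w with
  | H I ih =>
    rcases I.eq_empty_or_nonempty with rfl | hne
    · simp [face] at hx
    obtain ⟨ℓ, hℓ⟩ : ∃ ℓ, I.card = ℓ + 1 := ⟨I.card - 1, by have := hne.card_pos; omega⟩
    have hℓn : ℓ < n := by omega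
    have hF := hframe ⟨ℓ, hℓn⟩ ⟨I, hℓ⟩
    have hcomp : ∀ u v : E n, v ∈ (vectorSpan ℝ (s.points '' (I : Set (Fin (n + 1)))))ᗮ →
        (∀ q ∈ polyOn ((k : ℤ) - ℓ - 1) (face s I),
          meanMoment s (ℓ := ℓ) ⟨I, hℓ⟩ τ u v q = 0) →
        ∀ y : face s I, u.ofLp ⬝ᵥ τ (Set.inclusion (face_subset_body s I) y) *ᵥ v.ofLp = 0 := by
      intro u v hv hmom
      refine eq_zero_of_vanish_of_moments s hk hℓ
        (component (k : ℤ) (face_subset_body s I) u v ⟨τ, hτ⟩).2 (fun i hi y hy => ?_) hmom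
      -- Passing to a subface shrinks the tangent space and enlarges the normal space, so the
      -- induction hypothesis applies to the same $v$.
      have hv' : v ∈ (vectorSpan ℝ (s.points '' ((I.erase i : Finset _) : Set (Fin (n + 1)))))ᗮ :=
        Submodule.orthogonal_le (vectorSpan_mono ℝ (Set.image_mono
          (by exact_mod_cast Finset.erase_subset i I))) hv
      have h0 := ih (I.erase i) (Finset.erase_ssubset hi)
        ((Finset.card_le_card (Finset.erase_subset i I)).trans hIn) y hy v hv'
      change u.ofLp ⬝ᵥ τ _ *ᵥ v.ofLp = 0
      exact (congrArg (u.ofLp ⬝ᵥ ·) h0).trans (dotProduct_zero _)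
    have hsymm := hτ.1 ⟨x, face_subset_body s I hx⟩
    set S := τ ⟨x, face_subset_body s I hx⟩
    have hνzero : ∀ b, S *ᵥ (ν ⟨ℓ, hℓn⟩ ⟨I, hℓ⟩ b).ofLp = 0 := by
      intro b
      have h0 : WithLp.toLp 2 (S *ᵥ (ν ⟨ℓ, hℓn⟩ ⟨I, hℓ⟩ b).ofLp) = (0 : E n) := by
        refine hF.eq_zero (fun a => ?_) (fun c => ?_)
        · rw [← dotProduct_ofLp_eq_inner]
          exact hcomp _ _ (hF.normal_mem b) (htn ⟨ℓ, hℓn⟩ ⟨I, hℓ⟩ a b) ⟨x, hx⟩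
        · rw [← dotProduct_ofLp_eq_inner]
          rcases le_total c b with hcb | hcb
          · exact hcomp _ _ (hF.normal_mem b) (hnn ⟨ℓ, hℓn⟩ ⟨I, hℓ⟩ c b hcb) ⟨x, hx⟩
          -- Only ordered pairs of normals carry moments; the reversed pair follows from the
          -- symmetry of $\tau$.
          · have := hcomp _ _ (hF.normal_mem c) (hnn ⟨ℓ, hℓn⟩ ⟨I, hℓ⟩ b c hcb) ⟨x, hx⟩
            rw [Matrix.dotProduct_mulVec, ← Matrix.mulVec_transpose, dotProduct_comm] at this
            rw [← hsymm.eq]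
            exact this
      simpa using h0
    rw [← hF.span_normal] at hw
    induction hw using Submodule.span_induction with
    | mem _ h =>
      obtain ⟨b, rfl⟩ := h
      exact hνzero b
    | zero => simp
    | add a b _ _ ha hb => rw [WithLp.ofLp_add, Matrix.mulVec_add, ha, hb, add_zero]
    | smul c a _ ha => rw [WithLp.ofLp_smul, Matrix.mulVec_smul, ha, smul_zero]

/-- The coordinate $\lambda_m$ is zero at every vertex of the facet opposite $x_m$, hence constant
along it. -/
theorem toLp_grad_mem_orthogonal (s : Splx n) (m : Fin (n + 1)) :
    (WithLp.toLp 2 (grad s m) : E n) ∈ (vectorSpan ℝ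
      (s.points '' ((Finset.univ.erase m : Finset _) : Set (Fin (n + 1)))))ᗮ := by
  rw [Submodule.mem_orthogonal]
  intro u hu
  rw [vectorSpan_def] at hu
  induction hu using Submodule.span_induction with
  | mem _ h =>
    obtain ⟨_, ⟨i, hi, rfl⟩, _, ⟨j, hj, rfl⟩, rfl⟩ := h
    rw [real_inner_comm, ← dotProduct_ofLp_eq_inner]
    refine (grad_dotProduct_sub s m _ _).trans ?_
    have hi : m ≠ i := by simpa [eq_comm] using hi
    have hj : m ≠ j := by simpa [eq_comm] using hj
    rw [bary_point, bary_point, if_neg hi, if_neg hj, sub_zero]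
  | zero => exact inner_zero_left _
  | add a b _ _ ha hb => rw [inner_add_left, ha, hb, add_zero]
  | smul c a _ ha => rw [inner_smul_left, ha, mul_zero]

/-- A symmetric matrix field whose normal components vanish on the facets is in the bubble space. -/
theorem mem_bubble_of_mulVec_grad (hk : 1 ≤ k) {τ : body s → Matrix (Fin n) (Fin n) ℝ}
    (hτ : τ ∈ symPolyOn (k : ℤ) (body s))
    (h : ∀ (m : Fin (n + 1)) (x : body s), x.1 ∈ face s (Finset.univ.erase m) →
      τ x *ᵥ grad s m = 0) : τ ∈ bubble s k := by
  have hQ : ∀ p : Edge n, ∃ q : polyOn ((k : ℤ) - 2) (body s), ∀ x : body s,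
      -(grad s p.1.1 ⬝ᵥ τ x *ᵥ grad s p.1.2) = bary s p.1.1 x.1 * bary s p.1.2 x.1 * q.1 x := by
    intro p
    obtain ⟨P, hP, hPf⟩ := (mem_polyOn_iff s).1
      (Submodule.neg_mem _ (dotProduct_mulVec_mem_polyOn hτ (grad s p.1.1) (grad s p.1.2)))
    have hbody : ∀ j, ∀ x ∈ face s (Finset.univ.erase j), x ∈ body s := fun j x hx =>
      face_subset_body s _ hx
    obtain ⟨Q, hQ, hPQ⟩ := exists_eq_prod_bary_mul s (by omega) (I := Finset.univ)
      (J := {p.1.1, p.1.2}) hP fun j hj x hx => by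
        rw [← hPf ⟨x, hbody j x hx⟩]
        have h0 := h j ⟨x, hbody j x hx⟩ hx
        simp only [Pi.neg_apply, neg_eq_zero]
        -- On the facet opposite the first endpoint, symmetry moves $\tau$ onto the left gradient;
        -- on the other facet $\tau$ already acts on the right one.
        rcases Finset.mem_insert.1 hj with rfl | hj
        · rw [Matrix.dotProduct_mulVec, ← Matrix.mulVec_transpose, (hτ.1 _).eq, h0,
            zero_dotProduct]
        · rw [Finset.mem_singleton] at hj
          rw [← hj, h0, dotProduct_zero]
    rw [Finset.card_pair p.2.ne] at hQ
    refine ⟨⟨_, (mem_polyOn_iff s).2 ⟨Q, hQ, fun x => rfl⟩⟩, fun x => ?_⟩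
    have hx : x.1 ∈ face s Finset.univ := by
      rw [face_univ]
      exact x.2
    refine (hPf x).trans ((hPQ x hx).trans ?_)
    rw [Finset.prod_pair p.2.ne]
  choose q hq using hQ
  rw [← range_bubbleMap]
  refine ⟨q, ?_⟩
  rw [bubbleMap_apply, ← edgeCombo_grad s hτ.1]
  congr 1
  ext p x
  rw [hq]

theorem dofMap_injective (hk : 1 ≤ k)
    (hframe : ∀ ℓ I, IsFrame s I (t ℓ I) (ν ℓ I)) : Function.Injective (dofMap s k t ν) := by
  rw [← LinearMap.ker_eq_bot, LinearMap.ker_eq_bot']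
  rintro ⟨τ, hτ⟩ h0
  have hface : ∀ (ℓ : Fin n) (I : FaceIdx n ℓ), (dofMap s k t ν ⟨τ, hτ⟩).1 ℓ I = 0 :=
    fun ℓ I => congrFun (congrFun (congrArg Prod.fst h0) ℓ) I
  have hnormal := mulVec_normal_eq_zero hk hframe hτ
    (fun ℓ I a b q hq => LinearMap.congr_fun
      (congrFun (congrFun (congrArg Prod.fst (hface ℓ I)) a) b) ⟨q, hq⟩)
    (fun ℓ I b c hbc q hq => LinearMap.congr_fun
      (congrFun (congrArg Prod.snd (hface ℓ I)) ⟨(b, c), hbc⟩) ⟨q, hq⟩)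
  have hbub : τ ∈ bubble s k := mem_bubble_of_mulVec_grad hk hτ fun m x hx =>
    hnormal _ (by simp) x hx _ (toLp_grad_mem_orthogonal s m)
  -- The face moments have put $\tau$ in the bubble space, so it is an admissible test field for
  -- itself.
  have hint : interiorMoment s τ τ = 0 :=
    LinearMap.congr_fun (congrArg Prod.snd h0) ⟨τ, hbub⟩
  have hnonneg : ∀ x i j, 0 ≤ τ x i j * τ x i j := fun x i j => mul_self_nonneg _
  have hzero := eq_zero_of_integral_eq_zero _
    (continuous_finsetSum _ fun i _ => continuous_finsetSum _ fun j _ =>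
      (continuous_apply_of_mem_symPolyOn hτ i j).mul (continuous_apply_of_mem_symPolyOn hτ i j))
    (fun x => Finset.sum_nonneg fun i _ => Finset.sum_nonneg fun j _ => hnonneg x i j) hint
  ext x i j
  have h1 := (Finset.sum_eq_zero_iff_of_nonneg fun i _ =>
    Finset.sum_nonneg fun j _ => hnonneg x i j).1 (hzero x) i (Finset.mem_univ i)
  have h2 := (Finset.sum_eq_zero_iff_of_nonneg fun j _ => hnonneg x i j).1 h1 j (Finset.mem_univ j)
  exact mul_self_eq_zero.1 h2

end Unisolvence

theorem finrank_faceDofs {n k ℓ : ℕ} (s : Splx n) (hk : 1 ≤ k) (hℓ : ℓ ≤ n) (I : FaceIdx n ℓ) :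
    Module.finrank ℝ (FaceDofs s k I) =
      ((n + 1 - ℓ).choose 2 + ℓ * (n - ℓ)) * (k - 1).choose ℓ := by
  rw [Module.finrank_prod, Module.finrank_pi_fintype, Module.finrank_pi_fintype]
  simp only [Module.finrank_pi_fintype, Subspace.dual_finrank_eq, finrank_polyOn_face_sub s hk I.2,
    Finset.sum_const, Finset.card_univ, card_le_pairs, Fintype.card_fin, smul_eq_mul]
  rw [show n - ℓ + 1 = n + 1 - ℓ by omega]
  ring

theorem card_faceIdx (n ℓ : ℕ) : Nat.card (FaceIdx n ℓ) = (n + 1).choose (ℓ + 1) := by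
  rw [Nat.card_eq_fintype_card, Fintype.card_finset_len, Fintype.card_fin]

theorem finrank_dofs {n k : ℕ} (s : Splx n) (hn : 1 ≤ n) (hk : 1 ≤ k) :
    Module.finrank ℝ (Dofs s k) = (n * (n + 1) / 2) * (n + k).choose n := by
  rw [← sum_dofs n k hn hk, Module.finrank_prod, Subspace.dual_finrank_eq, finrank_bubble s hn hk,
    Module.finrank_pi_fintype, Finset.sum_range]
  congr 1
  refine Finset.sum_congr rfl fun ℓ _ => ?_
  rw [Module.finrank_pi_fintype]
  simp only [finrank_faceDofs s hk ℓ.2.le, Finset.sum_const, Finset.card_univ, smul_eq_mul]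
  rw [choose_two_add_mul ℓ.2.le, ← Nat.card_eq_fintype_card, card_faceIdx]

end SymTensorElement

end

theorem theorem2p1 (n k : ℕ) (hn : 1 ≤ n) (hk : 1 ≤ k)
    (s : SymTensorElement.Splx n)
    (t : (ℓ : Fin n) → SymTensorElement.FaceIdx n ℓ → Fin ℓ → SymTensorElement.E n)
    (ν : (ℓ : Fin n) → SymTensorElement.FaceIdx n ℓ → Fin (n - ℓ) → SymTensorElement.E n)
    (hframe : ∀ (ℓ : Fin n) (I : SymTensorElement.FaceIdx n ℓ),
      SymTensorElement.IsFrame s I (t ℓ I) (ν ℓ I)) :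
    -- unisolvence: the degrees of freedom identify `P_k(K; 𝕊)` with the space of their values
    (∃ Φ : SymTensorElement.symPolyOn (k : ℤ) (SymTensorElement.body s) ≃ₗ[ℝ]
        SymTensorElement.Dofs s k,
      ∀ τ : SymTensorElement.symPolyOn (k : ℤ) (SymTensorElement.body s),
        (∀ (ℓ : Fin n) (I : SymTensorElement.FaceIdx n ℓ),
          (∀ a b q, ((Φ τ).1 ℓ I).1 a b q =
            SymTensorElement.meanMoment s I τ.1 (t ℓ I a) (ν ℓ I b) q.1) ∧
          (∀ p q, ((Φ τ).1 ℓ I).2 p q =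
            SymTensorElement.meanMoment s I τ.1 (ν ℓ I p.1.1) (ν ℓ I p.1.2) q.1)) ∧
        (∀ θ, (Φ τ).2 θ = SymTensorElement.interiorMoment s τ.1 θ.1)) ∧
    -- the number of degrees of freedom on each subsimplex, in both forms
    (∀ (ℓ : Fin n) (I : SymTensorElement.FaceIdx n ℓ),
      Module.finrank ℝ (SymTensorElement.FaceDofs s k I) =
        ((n + 1 - (ℓ : ℕ)).choose 2 + ℓ * (n - ℓ)) * (k - 1).choose ℓ ∧
      ((n + 1 - (ℓ : ℕ)).choose 2 + ℓ * (n - ℓ)) * (k - 1).choose ℓ =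
        ((n - ℓ) * (n + ℓ + 1) / 2) * (k - 1).choose ℓ) ∧
    -- the number of subsimplices of each dimension
    (∀ ℓ : Fin n, Nat.card (SymTensorElement.FaceIdx n ℓ) = (n + 1).choose (ℓ + 1)) ∧
    -- the number of interior degrees of freedom
    Module.finrank ℝ (Module.Dual ℝ (SymTensorElement.bubble s k)) =
      ((n + 1) * n / 2) * (n + k - 2).choose n ∧
    -- the total number of degrees of freedom is the dimension of `P_k(K; 𝕊)`
    (∑ ℓ ∈ Finset.range n,
        (n + 1).choose (ℓ + 1) * (((n - ℓ) * (n + ℓ + 1) / 2) * (k - 1).choose ℓ)) +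
      ((n + 1) * n / 2) * (n + k - 2).choose n = (n * (n + 1) / 2) * (n + k).choose n ∧
    Module.finrank ℝ (SymTensorElement.symPolyOn (k : ℤ) (SymTensorElement.body s)) =
      (n * (n + 1) / 2) * (n + k).choose n := by
  have hdim := SymTensorElement.finrank_symPolyOn s k
  -- Injectivity with equal finite dimensions gives bijectivity; the moment formulas then hold by
  -- definition of `dofMap`.
  refine ⟨⟨LinearMap.linearEquivOfInjective (SymTensorElement.dofMap s k t ν)
    (SymTensorElement.dofMap_injective hk hframe)
    (hdim.trans (SymTensorElement.finrank_dofs s hn hk).symm),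
    fun τ => ⟨fun ℓ I => ⟨fun a b q => rfl, fun p q => rfl⟩, fun θ => rfl⟩⟩,
    fun ℓ I => ⟨SymTensorElement.finrank_faceDofs s hk ℓ.2.le I, ?_⟩,
    fun ℓ => SymTensorElement.card_faceIdx n ℓ, ?_, SymTensorElement.sum_dofs n k hn hk, hdim⟩
  · rw [SymTensorElement.choose_two_add_mul ℓ.2.le]
  · rw [Subspace.dual_finrank_eq, SymTensorElement.finrank_bubble s hn hk]
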